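/- For a group $G$, let $\vec{\mathcal G}(G)$ be its directed power graph, the simple digraph with vertex set $G$ in which, for distinct $x,y\in G$, there is an arc $x\to y$ if and only if $y^n=x$ for some nonzero integer $n$; let $\mathcal G(G)$ be its power graph, the underlying simple graph of $\vec{\mathcal G}(G)$. A Prüfer (quasicyclic) group is a group isomorphic, for some prime $p$, to the group $C_{p^\infty}$ of all complex roots of unity of $p$-power order. (1) Let $G$ and $H$ be nilpotent groups, neither of which is a Prüfer group. If $\mathcal G(G)\cong\mathcal G(H)$, then $\vec{\mathcal G}(G)\cong\vec{\mathcal G}(H)$. (2) Consequently, among nilpotent groups, the Prüfer groups are exactly the groups whose power graph does not determine the directed power graph: for a nilpotent group $G$, there exists a nilpotent group $H$ with $\mathcal G(G)\cong\mathcal G(H)$ and $\vec{\mathcal G}(G)\not\cong\vec{\mathcal G}(H)$ if and only if $G$ is a Prüfer group. -/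

import Mathlib

universe u v

/-- The directed power graph of a group `G`: the simple digraph (no loops) on `G` with an arc
from `x` to `y` if `y ^ n = x` for some nonzero integer `n`. -/
def directedPowerGraph (G : Type*) [Group G] : Digraph G where
  Adj x y := x ≠ y ∧ ∃ n : ℤ, n ≠ 0 ∧ y ^ n = x

/-- The power graph of a group `G`: the underlying simple graph of its directed power graph. -/
def powerGraph (G : Type*) [Group G] : SimpleGraph G :=
  (directedPowerGraph G).toSimpleGraphInclusive

/-- Two groups have isomorphic power graphs. -/
def PowerGraphIso (G H : Type*) [Group G] [Group H] : Prop :=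
  Nonempty (powerGraph G ≃g powerGraph H)

/-- Two groups have isomorphic directed power graphs. -/
def DirectedPowerGraphIso (G H : Type*) [Group G] [Group H] : Prop :=
  Nonempty ((directedPowerGraph G).Adj ≃r (directedPowerGraph H).Adj)

/-- `G` is a Prüfer (quasicyclic) group: for some prime `p` it is isomorphic to the group
of all complex roots of unity whose order is a power of `p`. -/
def IsPruferGroup (G : Type*) [Group G] : Prop :=
  ∃ p : ℕ, p.Prime ∧ Nonempty (G ≃* CommGroup.primaryComponent ℂˣ p)

/-! The power graph is the comparability graph of the preorder `≼`, whose connected components are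
the commensurability classes: the torsion elements form one, and infinite-order elements with a
common nonzero power form the others. Since `≼` never relates different components, it suffices to
find, for each component, some directed isomorphism onto its image component
(`exists_equiv_of_componentIso`); the given `f` only matches components up. That `f` preserves
torsion follows from the size of twin classes.

In a component of infinite order, non-edges force the orientation up to reversal. If one element is
linked to all others, the component is the nonzero integers under divisibility. Otherwise `f`
preserves or reverses `≼` there, and reversal forces unique roots, so that both components are
copies of the nonzero rationals. No nilpotency is needed for this.

In the torsion component, elements of coprime order commute by nilpotency. If two primes occur as
orders, twins other than 1 generate the same cyclic group, so twin classes reveal the totients of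
orders, and these fix the direction. If torsion is primary, each element is compared with those
whose neighbourhood contains its own. When these sets are finite, cardinalities determine how many
twins have each order, and `f` can be corrected inside twin classes. When one is infinite, torsion
is a single Prüfer chain.

The torsion component is then a complete graph that hides the prime `p`. If some `x` has infinite
order, the chain is central, and the covers of `x ^ p` having no common root with `x` are exactly
the `2 * (p - 1)` products of `x` or its inverse with an element of order `p`. Counting them
recovers `p` (`prime_le_of_infiniteTorsionChain`). Only Prüfer groups remain: for different primes
their power graphs are countably infinite complete graphs, but the directed graphs see the orders.
-/

namespace NilpotentPowerGraph

open Subgroup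
open scoped commutatorElement

/-! ### The power preorder, its components and its twins -/

section Basic

variable {G : Type*} [Group G]

/-- `x` is a nonzero integer power of `y`. -/
def IsNonzeroPower (x y : G) : Prop := ∃ n : ℤ, n ≠ 0 ∧ y ^ n = x

infix:50 " ≼ " => IsNonzeroPower

/-- Adjacency or equality in the power graph. -/
def Linked (x y : G) : Prop := x ≼ y ∨ y ≼ x

/-- Some nonzero powers of `x` and `y` agree. -/
def Commensurable (x y : G) : Prop := ∃ z : G, z ≼ x ∧ z ≼ y

/-- `x` and `y` have the same closed neighbourhood in the power graph. -/
def Twins (x y : G) : Prop := ∀ z, Linked z x ↔ Linked z y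

theorem IsNonzeroPower.refl (x : G) : x ≼ x := ⟨1, one_ne_zero, zpow_one x⟩

theorem IsNonzeroPower.trans {x y z : G} : x ≼ y → y ≼ z → x ≼ z := by
  rintro ⟨m, hm, rfl⟩ ⟨n, hn, rfl⟩
  exact ⟨n * m, mul_ne_zero hn hm, zpow_mul z n m⟩

theorem zpow_isNonzeroPower (x : G) {n : ℤ} (hn : n ≠ 0) : x ^ n ≼ x := ⟨n, hn, rfl⟩

theorem IsNonzeroPower.mem_zpowers {x y : G} : x ≼ y → x ∈ zpowers y := by
  rintro ⟨n, -, rfl⟩; exact zpow_mem_zpowers y n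

theorem inv_isNonzeroPower (x : G) : x⁻¹ ≼ x := ⟨-1, by decide, by simp⟩

theorem isNonzeroPower_inv (x : G) : x ≼ x⁻¹ := ⟨-1, by decide, by simp⟩

theorem isNonzeroPower_iff_of_isOfFinOrder {x y : G} (hy : IsOfFinOrder y) :
    x ≼ y ↔ x ∈ zpowers y := by
  refine ⟨IsNonzeroPower.mem_zpowers, ?_⟩
  rintro ⟨n, rfl⟩
  by_cases hn : n = 0
  · exact ⟨orderOf y, by exact_mod_cast hy.orderOf_pos.ne', by simp [hn, pow_orderOf_eq_one]⟩
  · exact ⟨n, hn, rfl⟩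

theorem isNonzeroPower_iff_of_not_isOfFinOrder {x y : G} (hx : ¬ IsOfFinOrder x) :
    x ≼ y ↔ x ∈ zpowers y := by
  refine ⟨IsNonzeroPower.mem_zpowers, ?_⟩
  rintro ⟨n, rfl⟩
  refine ⟨n, ?_, rfl⟩
  rintro rfl
  simp at hx

theorem isOfFinOrder_zpow_iff {x : G} {n : ℤ} (hn : n ≠ 0) :
    IsOfFinOrder (x ^ n) ↔ IsOfFinOrder x := by
  refine ⟨fun h => ?_, fun h => h.zpow⟩
  obtain ⟨m, hm, h⟩ := isOfFinOrder_iff_zpow_eq_one.1 h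
  exact isOfFinOrder_iff_zpow_eq_one.2 ⟨n * m, mul_ne_zero hn hm, by rw [zpow_mul, h]⟩

theorem IsNonzeroPower.isOfFinOrder_iff {x y : G} : x ≼ y → (IsOfFinOrder x ↔ IsOfFinOrder y) := by
  rintro ⟨n, hn, rfl⟩; exact isOfFinOrder_zpow_iff hn

theorem Linked.refl (x : G) : Linked x x := Or.inl (.refl x)

theorem Linked.symm {x y : G} (h : Linked x y) : Linked y x := Or.symm h

theorem linked_comm {x y : G} : Linked x y ↔ Linked y x := ⟨.symm, .symm⟩

theorem Linked.isOfFinOrder_iff {x y : G} (h : Linked x y) : IsOfFinOrder x ↔ IsOfFinOrder y :=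
  h.elim (fun h => h.isOfFinOrder_iff) (fun h => h.isOfFinOrder_iff.symm)

theorem Twins.linked {x y : G} (h : Twins x y) : Linked x y := (h x).1 (.refl x)

theorem Twins.symm {x y : G} (h : Twins x y) : Twins y x := fun z => (h z).symm

theorem Twins.trans {x y z : G} (h : Twins x y) (h' : Twins y z) : Twins x z :=
  fun w => (h w).trans (h' w)

theorem IsNonzeroPower.twins {x y : G} (h : x ≼ y) (h' : y ≼ x) : Twins x y := fun _ =>
  ⟨fun hz => hz.imp (fun k => k.trans h) (fun k => h'.trans k),
    fun hz => hz.imp (fun k => k.trans h') (fun k => h.trans k)⟩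

theorem twins_inv (x : G) : Twins x⁻¹ x := (inv_isNonzeroPower x).twins (isNonzeroPower_inv x)

theorem Twins.linked_congr {a b c d : G} (h : Twins a b) (h' : Twins c d) :
    Linked a c ↔ Linked b d :=
  (h' a).trans (linked_comm.trans ((h d).trans linked_comm))

theorem Commensurable.refl (x : G) : Commensurable x x := ⟨x, .refl x, .refl x⟩

theorem Commensurable.symm {x y : G} : Commensurable x y → Commensurable y x :=
  fun ⟨z, h, h'⟩ => ⟨z, h', h⟩

theorem IsNonzeroPower.commensurable {x y : G} (h : x ≼ y) : Commensurable x y := ⟨x, .refl x, h⟩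

theorem Commensurable.trans {x y z : G} : Commensurable x y → Commensurable y z →
    Commensurable x z := by
  rintro ⟨u, hux, ⟨n, hn, rfl⟩⟩ ⟨w, ⟨m, hm, rfl⟩, hwz⟩
  refine ⟨y ^ (n * m), ?_, ?_⟩
  · rw [zpow_mul]; exact (zpow_isNonzeroPower _ hm).trans hux
  · rw [mul_comm, zpow_mul]; exact (zpow_isNonzeroPower _ hn).trans hwz

theorem Linked.commensurable {x y : G} (h : Linked x y) : Commensurable x y :=
  h.elim (·.commensurable) (·.commensurable.symm)

theorem Commensurable.isOfFinOrder_iff {x y : G} :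
    Commensurable x y → (IsOfFinOrder x ↔ IsOfFinOrder y) :=
  fun ⟨_, h, h'⟩ => h.isOfFinOrder_iff.symm.trans h'.isOfFinOrder_iff

theorem IsOfFinOrder.one_isNonzeroPower {x : G} (hx : IsOfFinOrder x) : 1 ≼ x :=
  (isNonzeroPower_iff_of_isOfFinOrder hx).2 (one_mem _)

theorem IsOfFinOrder.commensurable {x y : G} (hx : IsOfFinOrder x) (hy : IsOfFinOrder y) :
    Commensurable x y := ⟨1, IsOfFinOrder.one_isNonzeroPower hx, IsOfFinOrder.one_isNonzeroPower hy⟩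

/-- The setoid whose classes are the connected components of the power graph. -/
def commensurableSetoid (G : Type*) [Group G] : Setoid G where
  r := Commensurable
  iseqv := ⟨.refl, .symm, .trans⟩

theorem Commensurable.exists_zpow_eq {x y : G} : Commensurable x y →
    ∃ m n : ℤ, m ≠ 0 ∧ n ≠ 0 ∧ x ^ m = y ^ n := by
  rintro ⟨_, ⟨m, hm, rfl⟩, ⟨n, hn, h⟩⟩
  exact ⟨m, n, hm, hn, h.symm⟩

theorem commensurable_of_zpow_eq {x y : G} {m n : ℤ} (hm : m ≠ 0) (hn : n ≠ 0)
    (h : x ^ m = y ^ n) : Commensurable x y := ⟨x ^ m, ⟨m, hm, rfl⟩, ⟨n, hn, h.symm⟩⟩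

theorem IsNonzeroPower.orderOf_dvd {x y : G} (h : x ≼ y) : orderOf x ∣ orderOf y := by
  obtain ⟨n, -, rfl⟩ := h
  exact orderOf_dvd_of_mem_zpowers (zpow_mem_zpowers y n)

theorem zpowers_le_of_isNonzeroPower {x y : G} (h : x ≼ y) : zpowers x ≤ zpowers y :=
  zpowers_le.2 h.mem_zpowers

theorem IsNonzeroPower.zpowers_eq {x y : G} (h : x ≼ y) (h' : y ≼ x) : zpowers x = zpowers y :=
  le_antisymm (zpowers_le_of_isNonzeroPower h) (zpowers_le_of_isNonzeroPower h')

theorem isNonzeroPower_of_zpowers_eq {x y : G} (h : zpowers x = zpowers y) (hy : IsOfFinOrder y) :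
    x ≼ y := (isNonzeroPower_iff_of_isOfFinOrder hy).2 (h ▸ mem_zpowers x)

/-- For powers `z ^ i` and `z ^ j` the orders are the order of `z` divided by its gcd with `i` and
`j`, so divisibility of orders reverses into divisibility of gcds, and Bézout places `z ^ gcd` in
the group of `z ^ j`. -/
theorem mem_zpowers_of_orderOf_dvd {x y z : G} (hx : x ∈ zpowers z) (hy : y ∈ zpowers z)
    (hz : IsOfFinOrder z) (h : orderOf x ∣ orderOf y) : x ∈ zpowers y := by
  obtain ⟨i, rfl⟩ := hz.mem_powers_iff_mem_zpowers.2 hx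
  obtain ⟨j, rfl⟩ := hz.mem_powers_iff_mem_zpowers.2 hy
  simp only at h ⊢
  rw [hz.orderOf_pow, hz.orderOf_pow] at h
  have hN := hz.orderOf_pos
  have hd : (orderOf z).gcd j ∣ (orderOf z).gcd i := by
    obtain ⟨c, hc⟩ := h
    have h1 := Nat.div_mul_cancel (Nat.gcd_dvd_left (orderOf z) i)
    have h2 := Nat.div_mul_cancel (Nat.gcd_dvd_left (orderOf z) j)
    rw [hc] at h2
    refine ⟨c, Nat.eq_of_mul_eq_mul_left (Nat.div_pos
      (Nat.le_of_dvd hN (Nat.gcd_dvd_left _ i)) (Nat.gcd_pos_of_pos_left _ hN)) ?_⟩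
    linarith
  obtain ⟨k, hk⟩ := hd.trans (Nat.gcd_dvd_right _ _)
  have hg : z ^ (orderOf z).gcd j ∈ zpowers (z ^ j) := by
    refine ⟨(orderOf z).gcdB j, ?_⟩
    simp only
    rw [← zpow_natCast z ((orderOf z).gcd j), Nat.gcd_eq_gcd_ab, zpow_add, zpow_mul, zpow_mul]
    simp
  rw [hk, pow_mul]
  exact pow_mem hg k

theorem IsNonzeroPower.of_orderOf_dvd {x y : G} (hx : IsOfFinOrder x) (h : x ≼ y)
    (hd : orderOf y ∣ orderOf x) : y ≼ x :=
  (isNonzeroPower_iff_of_isOfFinOrder hx).2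
    (mem_zpowers_of_orderOf_dvd (Subgroup.mem_zpowers y) h.mem_zpowers (h.isOfFinOrder_iff.1 hx) hd)

theorem Linked.isNonzeroPower_of_orderOf_dvd {x y : G} (hx : IsOfFinOrder x) (h : Linked x y)
    (hd : orderOf x ∣ orderOf y) : x ≼ y :=
  h.elim id fun h => h.of_orderOf_dvd (h.isOfFinOrder_iff.2 hx) hd

end Basic

/-! ### Powers of an element of infinite order -/

section InfiniteOrder

variable {G : Type*} [Group G] {x y : G}

theorem zpow_left_inj (hx : ¬ IsOfFinOrder x) {m n : ℤ} : x ^ m = x ^ n ↔ m = n :=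
  (injective_zpow_iff_not_isOfFinOrder.2 hx).eq_iff

theorem zpow_isNonzeroPower_zpow (hx : ¬ IsOfFinOrder x) {m n : ℤ} (hm : m ≠ 0) :
    x ^ m ≼ x ^ n ↔ n ∣ m := by
  constructor
  · rintro ⟨k, hk, h⟩
    rw [← zpow_mul, zpow_left_inj hx] at h
    exact ⟨k, h.symm⟩
  · rintro ⟨k, rfl⟩
    exact ⟨k, right_ne_zero_of_mul hm, (zpow_mul x n k).symm⟩

theorem linked_zpow_zpow (hx : ¬ IsOfFinOrder x) {m n : ℤ} (hm : m ≠ 0) (hn : n ≠ 0) :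
    Linked (x ^ m) (x ^ n) ↔ n ∣ m ∨ m ∣ n :=
  or_congr (zpow_isNonzeroPower_zpow hx hm) (zpow_isNonzeroPower_zpow hx hn)

theorem IsNonzeroPower.eq_or_eq_inv (hx : ¬ IsOfFinOrder x) (h : x ≼ y) (h' : y ≼ x) :
    y = x ∨ y = x⁻¹ := by
  obtain ⟨n, hn, rfl⟩ := h'
  have h : x ^ (1 : ℤ) ≼ x ^ n := by simpa using h
  rw [zpow_isNonzeroPower_zpow hx one_ne_zero] at h
  rcases Int.isUnit_iff.1 (isUnit_of_dvd_one h) with rfl | rfl <;> simp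

theorem exists_prime_not_dvd (n : ℤ) (hn : n ≠ 0) :
    ∃ q : ℕ, q.Prime ∧ 2 < q ∧ ¬ (q : ℤ) ∣ n := by
  obtain ⟨q, hq, hp⟩ := Nat.exists_infinite_primes (n.natAbs + 3)
  refine ⟨q, hp, by omega, fun h => ?_⟩
  have := Nat.le_of_dvd (Int.natAbs_pos.2 hn) (Int.natCast_dvd.1 h)
  omega

/-- The source of non-edges: all forcing arguments for infinite order pass through `x ^ q` with `q`
a prime avoiding the exponents in play. -/
theorem not_linked_zpow_prime (hx : ¬ IsOfFinOrder x) {n : ℤ} (hn : n ≠ 0) (h1 : ¬ IsUnit n)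
    {q : ℕ} (hq : q.Prime) (hqn : ¬ (q : ℤ) ∣ n) : ¬ Linked (x ^ n) (x ^ (q : ℤ)) := by
  rw [linked_zpow_zpow hx hn (by exact_mod_cast hq.ne_zero)]
  rintro (h | h)
  · exact hqn h
  · rcases (Nat.dvd_prime hq).1 (Int.natAbs_dvd_natAbs.2 h) with h' | h'
    · exact h1 (Int.isUnit_iff_natAbs_eq.2 h')
    · exact hqn (Int.natCast_dvd.2 (by simp [h']))

/-- For a non-unit exponent `n`, an element `x ^ q` with `q` a prime not dividing `n` is linked to
`x` but not to `x ^ n`. -/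
theorem Twins.eq_or_eq_inv (hx : ¬ IsOfFinOrder x) (h : Twins x y) : y = x ∨ y = x⁻¹ := by
  wlog hxy : y ≼ x generalizing x y
  · have hyx := h.linked.resolve_right hxy
    rcases this (fun hy => hx (hyx.isOfFinOrder_iff.2 hy)) h.symm hyx with rfl | rfl <;> simp
  obtain ⟨n, hn, rfl⟩ := hxy
  by_cases hu : IsUnit n
  · rcases Int.isUnit_iff.1 hu with rfl | rfl <;> simp
  obtain ⟨q, hq, -, hqn⟩ := exists_prime_not_dvd n hn
  refine absurd ?_ (not_linked_zpow_prime hx hn hu hq hqn)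
  exact ((h _).1 (Or.inl (zpow_isNonzeroPower x (by exact_mod_cast hq.ne_zero)))).symm

end InfiniteOrder

/-! ### Isomorphisms of power graphs -/

section LinkedEquiv

variable {G : Type*} {H : Type*} [Group G] [Group H] {f : G ≃ H}

/-- `f` is an isomorphism of power graphs. -/
def PreservesLinked (f : G ≃ H) : Prop := ∀ x y, Linked (f x) (f y) ↔ Linked x y

theorem PreservesLinked.symm (hf : PreservesLinked f) : PreservesLinked f.symm := fun x y => by
  rw [← hf, f.apply_symm_apply, f.apply_symm_apply]

theorem PreservesLinked.twins_iff (hf : PreservesLinked f) {x y : G} :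
    Twins (f x) (f y) ↔ Twins x y := by
  constructor
  · intro h z
    rw [← hf, ← hf]
    exact h (f z)
  · intro h z
    obtain ⟨z, rfl⟩ := f.surjective z
    rw [hf, hf]
    exact h z

theorem PreservesLinked.commensurable (hf : PreservesLinked f) {x y : G} :
    Commensurable x y → Commensurable (f x) (f y) := by
  rintro ⟨z, h, h'⟩
  exact ((hf x z).2 (Or.inr h)).commensurable.trans ((hf z y).2 (Or.inl h')).commensurable

theorem PreservesLinked.commensurable_iff (hf : PreservesLinked f) {x y : G} :
    Commensurable (f x) (f y) ↔ Commensurable x y :=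
  ⟨fun h => by simpa using hf.symm.commensurable h, hf.commensurable⟩

end LinkedEquiv

/-! ### Transitive orientations of an infinite-order component -/

section Orientation

variable {G : Type*} [Group G]

/-- A transitive relation with the power graph as its comparability graph. -/
structure IsOrientation (R : G → G → Prop) : Prop where
  trans : ∀ a b c, R a b → R b c → R a c
  linked_iff : ∀ a b, Linked a b ↔ R a b ∨ R b a
  inv_left : ∀ a, ¬ IsOfFinOrder a → R a⁻¹ a

variable {R : G → G → Prop}

theorem IsOrientation.inv_right (hR : IsOrientation R) {a : G} (ha : ¬ IsOfFinOrder a) :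
    R a a⁻¹ := by
  simpa using hR.inv_left a⁻¹ (by simpa using ha)

theorem IsOrientation.swap (hR : IsOrientation R) : IsOrientation (flip R) where
  trans _ _ _ h h' := hR.trans _ _ _ h' h
  linked_iff a b := linked_comm.trans (hR.linked_iff b a)
  inv_left _ ha := hR.inv_right ha

/-- Two edges at `a` with unlinked far ends must both point into `a` or both out of it, since a
directed path through `a` would link the ends by transitivity. -/
theorem IsOrientation.force_right (hR : IsOrientation R) {a b c : G} (hac : Linked a c)
    (hbc : ¬ Linked b c) (h : R b a) : R c a :=
  ((hR.linked_iff a c).1 hac).resolve_left fun h' =>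
    hbc ((hR.linked_iff b c).2 (Or.inl (hR.trans _ _ _ h h')))

theorem IsOrientation.force_left (hR : IsOrientation R) {a b c : G} (hac : Linked a c)
    (hbc : ¬ Linked b c) (h : R a b) : R a c :=
  hR.swap.force_right hac hbc h

/-- The direction passes from `x ^ n` to `x ^ q` and on to `x ^ m`, for a prime `q` dividing neither
exponent: neighbouring terms of this path are unlinked. -/
theorem IsOrientation.zpow_of_zpow (hR : IsOrientation R) {x : G} (hx : ¬ IsOfFinOrder x) {n : ℤ}
    (hn : n ≠ 0) (hu : ¬ IsUnit n) (h : R (x ^ n) x) (m : ℤ) (hm : m ≠ 0) : R (x ^ m) x := by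
  by_cases hmu : IsUnit m
  · rcases Int.isUnit_iff.1 hmu with rfl | rfl
    · simpa using (hR.linked_iff x x).1 (.refl x)
    · simpa using hR.inv_left x hx
  obtain ⟨q, hq, -, hqn⟩ := exists_prime_not_dvd (n * m) (mul_ne_zero hn hm)
  have hq0 : (q : ℤ) ≠ 0 := by exact_mod_cast hq.ne_zero
  have h1 := not_linked_zpow_prime hx hn hu hq fun h => hqn (h.mul_right m)
  have h2 := not_linked_zpow_prime hx hm hmu hq fun h => hqn (h.mul_left n)
  exact hR.force_right (Or.inr (zpow_isNonzeroPower x hm)) (fun h => h2 h.symm)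
    (hR.force_right (Or.inr (zpow_isNonzeroPower x hq0)) h1 h)

/-- All nonzero powers of `x` are `R`-below `x`. -/
def PowersBelow (R : G → G → Prop) (x : G) : Prop := ∀ m : ℤ, m ≠ 0 → R (x ^ m) x

theorem IsOrientation.powersBelow_or (hR : IsOrientation R) {x : G} (hx : ¬ IsOfFinOrder x) :
    PowersBelow R x ∨ PowersBelow (flip R) x := by
  have h2 : ¬ IsUnit (2 : ℤ) := by decide
  rcases (hR.linked_iff (x ^ (2 : ℤ)) x).1 (Or.inl (zpow_isNonzeroPower x two_ne_zero)) with h | h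
  · exact Or.inl (hR.zpow_of_zpow hx two_ne_zero h2 h)
  · exact Or.inr (hR.swap.zpow_of_zpow hx two_ne_zero h2 h)

/-- The common power `z ^ m = w ^ n` is joined to both `z` and `w`, which are unlinked, so its edge
to `z` forces its edge to `w`. -/
theorem IsOrientation.powersBelow_of_not_linked (hR : IsOrientation R) {z w : G}
    (hz : ¬ IsOfFinOrder z) (hzw : Commensurable z w) (hl : ¬ Linked z w) (h : PowersBelow R z) :
    PowersBelow R w := by
  have hw := fun k => hz (hzw.isOfFinOrder_iff.2 k)
  obtain ⟨m, n, hm, hn, he⟩ := hzw.exists_zpow_eq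
  have hu : ¬ IsUnit n := by
    intro hu
    apply hl
    rcases Int.isUnit_iff.1 hu with rfl | rfl
    · exact Or.inr ⟨m, hm, by simpa using he⟩
    · exact Or.inr ⟨-m, neg_ne_zero.2 hm, by simp [he]⟩
  refine hR.zpow_of_zpow hw hn hu ?_
  rw [← he]
  exact hR.force_left (by rw [he]; exact Or.inl (zpow_isNonzeroPower w hn)) hl (h m hm)

theorem IsOrientation.powersBelow_zpow (hR : IsOrientation R) {x : G} (hx : ¬ IsOfFinOrder x)
    {m n : ℤ} (hm : m ≠ 0) (hn : n ≠ 0) (hmu : ¬ IsUnit m) (hnu : ¬ IsUnit n)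
    (h : PowersBelow R (x ^ m)) : PowersBelow R (x ^ n) := by
  obtain ⟨q, hq, -, hqn⟩ := exists_prime_not_dvd (n * m) (mul_ne_zero hn hm)
  have hq0 : (q : ℤ) ≠ 0 := by exact_mod_cast hq.ne_zero
  have h1 := not_linked_zpow_prime hx hn hnu hq fun h => hqn (h.mul_right m)
  have h2 := not_linked_zpow_prime hx hm hmu hq fun h => hqn (h.mul_left n)
  have hc : ∀ {m : ℤ}, m ≠ 0 → Commensurable (x ^ m) x :=
    fun hm => (zpow_isNonzeroPower x hm).commensurable
  have hi : ∀ {m : ℤ}, m ≠ 0 → ¬ IsOfFinOrder (x ^ m) :=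
    fun hm => by rwa [isOfFinOrder_zpow_iff hm]
  exact hR.powersBelow_of_not_linked (hi hq0) ((hc hq0).trans (hc hn).symm) (fun h => h1 h.symm)
    (hR.powersBelow_of_not_linked (hi hm) ((hc hm).trans (hc hq0).symm) h2 h)

/-- If both `w ^ 2` and `w ^ 3` were powers of `x`, then so would be their quotient `w`; hence 2 or
3 serves. -/
theorem exists_zpow_not_linked {x w : G} (hw : ¬ IsOfFinOrder w) (h : ¬ Linked x w) :
    ∃ k : ℤ, k ≠ 0 ∧ ¬ IsUnit k ∧ ¬ Linked x (w ^ k) := by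
  have hx : ∀ k : ℤ, k ≠ 0 → ¬ x ≼ w ^ k := fun k hk h' =>
    h (Or.inl (h'.trans (zpow_isNonzeroPower w hk)))
  by_cases h2 : w ^ (2 : ℤ) ∈ zpowers x
  · refine ⟨3, by decide, by decide, ?_⟩
    rintro (h' | h')
    · exact hx 3 (by decide) h'
    · have := mul_mem h'.mem_zpowers (inv_mem h2)
      rw [← zpow_neg, ← zpow_add] at this
      exact h (Or.inr ((isNonzeroPower_iff_of_not_isOfFinOrder hw).2 (by simpa using this)))
  · refine ⟨2, by decide, by decide, ?_⟩
    rintro (h' | h')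
    · exact hx 2 (by decide) h'
    · exact h2 h'.mem_zpowers

theorem IsOrientation.powersBelow_of_commensurable (hR : IsOrientation R) {x y : G}
    (hx : ¬ IsOfFinOrder x) (hxy : Commensurable x y)
    (hxn : ∃ w, Commensurable x w ∧ ¬ Linked x w) (hyn : ∃ w, Commensurable y w ∧ ¬ Linked y w)
    (h : PowersBelow R x) : PowersBelow R y := by
  obtain ⟨w, hxw, hw⟩ := hxn
  obtain ⟨u, hyu, hu⟩ := hyn
  have hwi := fun k => hx (hxw.isOfFinOrder_iff.2 k)
  have hui := fun k => hx ((hxy.trans hyu).isOfFinOrder_iff.2 k)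
  obtain ⟨k, hk0, hku, hk⟩ := exists_zpow_not_linked hwi hw
  obtain ⟨j, hj0, hju, hj⟩ := exists_zpow_not_linked hui hu
  obtain ⟨s, t, hs, ht, hst⟩ := (hxw.symm.trans (hxy.trans hyu)).exists_zpow_eq
  -- The common power `w ^ s = u ^ t` is squared so that its exponents over `w` and `u` are never
  -- units, as `powersBelow_zpow` requires.
  have hn2 : ∀ s : ℤ, ¬ IsUnit (s * 2) := fun s hs => by
    rcases Int.isUnit_iff.1 hs with h | h <;> omega
  have h1 := hR.powersBelow_of_not_linked hx
    (hxw.trans (zpow_isNonzeroPower w hk0).commensurable.symm) hk h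
  have h2 := hR.powersBelow_zpow hwi hk0 (mul_ne_zero hs two_ne_zero) hku (hn2 s) h1
  rw [zpow_mul, hst, ← zpow_mul] at h2
  have h3 := hR.powersBelow_zpow hui (mul_ne_zero ht two_ne_zero) hj0 (hn2 t) hju h2
  exact hR.powersBelow_of_not_linked (by rwa [isOfFinOrder_zpow_iff hj0])
    ((zpow_isNonzeroPower u hj0).commensurable.trans hyu.symm) (fun h => hj h.symm) h3

end Orientation

/-! ### Preserving or reversing a component; dominating elements -/

section InfiniteOrder

variable {G : Type*} {H : Type*} [Group G] [Group H] {f : G ≃ H}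

theorem mutual_of_map_mutual (hf : PreservesLinked f) {x y : G} (hx : ¬ IsOfFinOrder x)
    (h : f x ≼ f y) (h' : f y ≼ f x) : x ≼ y ∧ y ≼ x := by
  rcases (hf.twins_iff.1 (h.twins h')).eq_or_eq_inv hx with rfl | rfl
  · exact ⟨.refl _, .refl _⟩
  · exact ⟨isNonzeroPower_inv x, inv_isNonzeroPower x⟩

theorem isOrientation_comap (hf : PreservesLinked f)
    (hfin : ∀ x, IsOfFinOrder (f x) ↔ IsOfFinOrder x) :
    IsOrientation fun a b => f a ≼ f b where
  trans _ _ _ h h' := h.trans h'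
  linked_iff a b := (hf a b).symm
  inv_left a ha := by
    rcases (hf.twins_iff.2 (twins_inv a).symm).eq_or_eq_inv (by rwa [hfin]) with h | h
    · rw [h]; exact .refl _
    · rw [h]; exact inv_isNonzeroPower _

/-- `x` is not linked to some element of its component. -/
def NonDominating (x : G) : Prop := ∃ w, Commensurable x w ∧ ¬ Linked x w

/-- Pulling `≼` back along `f` gives an orientation of the same graph. Its direction at `x₀` spreads
to the whole component because every element there has an unlinked partner. -/
theorem preserves_or_reverses (hf : PreservesLinked f)
    (hfin : ∀ x, IsOfFinOrder (f x) ↔ IsOfFinOrder x) {x₀ : G} (hx₀ : ¬ IsOfFinOrder x₀)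
    (hnd : ∀ y, Commensurable x₀ y → NonDominating y) :
    (∀ x y, Commensurable x₀ x → Commensurable x₀ y → (f x ≼ f y ↔ x ≼ y)) ∨
    (∀ x y, Commensurable x₀ x → Commensurable x₀ y → (f x ≼ f y ↔ y ≼ x)) := by
  have hR := isOrientation_comap hf hfin
  have key : ∀ {R : G → G → Prop}, IsOrientation R → PowersBelow R x₀ →
      ∀ x y, Commensurable x₀ y → x ≼ y → R x y := by
    rintro R hR h x y hy ⟨n, hn, rfl⟩
    exact hR.powersBelow_of_commensurable hx₀ hy (hnd x₀ (.refl x₀)) (hnd y hy) h n hn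
  have hi : ∀ {x}, Commensurable x₀ x → ¬ IsOfFinOrder x := fun h h' =>
    hx₀ (h.isOfFinOrder_iff.2 h')
  refine (hR.powersBelow_or hx₀).imp (fun h x y hx hy => ?_) (fun h x y hx hy => ?_)
  · refine ⟨fun h' => ?_, key hR h x y hy⟩
    rcases (hf x y).1 (Or.inl h') with h1 | h1
    · exact h1
    · exact (mutual_of_map_mutual hf (hi hx) h' (key hR h y x hx h1)).1
  · refine ⟨fun h' => ?_, key hR.swap h y x hx⟩
    rcases (hf x y).1 (Or.inl h') with h1 | h1
    · exact (mutual_of_map_mutual hf (hi hx) h' (key hR.swap h x y hy h1)).2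
    · exact h1

/-- If `x` were `z ^ n` with `n` not a unit, then `z ^ q` with a prime `q` not dividing `n` would
lie in the component and be unlinked to `x`. -/
theorem exists_zpow_of_dominating {x z : G} (hx : ¬ IsOfFinOrder x) (h : ¬ NonDominating x)
    (hz : Commensurable x z) : z ≼ x := by
  simp only [NonDominating, not_exists, not_and, not_not] at h
  rcases (h z hz).symm with h' | ⟨n, hn, rfl⟩
  · exact h'
  have hzi := fun k => hx (hz.isOfFinOrder_iff.2 k)
  by_cases hu : IsUnit n
  · rcases Int.isUnit_iff.1 hu with rfl | rfl
    · simpa using IsNonzeroPower.refl z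
    · simpa using isNonzeroPower_inv z
  obtain ⟨q, hq, -, hqn⟩ := exists_prime_not_dvd n hn
  have hq0 : (q : ℤ) ≠ 0 := by exact_mod_cast hq.ne_zero
  exact absurd (h _ (hz.trans (zpow_isNonzeroPower z hq0).commensurable.symm))
    (not_linked_zpow_prime hzi hn hu hq hqn)

end InfiniteOrder

/-! ### Counting generators of finite cyclic groups -/

section CyclicCounting

variable {G : Type*} [Group G]

theorem ncard_orderOf_eq_in_zpowers {y : G} (hy : IsOfFinOrder y) {d : ℕ} (hd : d ∣ orderOf y) :
    {z | z ∈ zpowers y ∧ orderOf z = d}.ncard = d.totient := by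
  classical
  have : Finite (zpowers y) := hy.finite_zpowers
  have := Fintype.ofFinite (zpowers y)
  rw [← IsCyclic.card_orderOf_eq_totient (α := zpowers y) (d := d)
    (by rwa [← Nat.card_eq_fintype_card, Nat.card_zpowers]), ← Set.ncard_coe_finset,
    ← Set.ncard_image_of_injective _ Subtype.val_injective]
  congr 1
  ext z
  simp only [Set.mem_ofPred_eq, Finset.coe_filter, Finset.mem_univ, true_and, Set.mem_image,
    Subtype.exists, exists_and_left, exists_prop, exists_eq_right_right, Subgroup.orderOf_mk]
  tauto

theorem zpowers_eq_iff_orderOf {y z : G} (hy : IsOfFinOrder y) :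
    zpowers z = zpowers y ↔ z ∈ zpowers y ∧ orderOf z = orderOf y := by
  constructor
  · intro h
    refine ⟨h ▸ mem_zpowers z, ?_⟩
    rw [← Nat.card_zpowers, h, Nat.card_zpowers]
  · rintro ⟨h, h'⟩
    have hz : z ≼ y := (isNonzeroPower_iff_of_isOfFinOrder hy).2 h
    exact hz.zpowers_eq (hz.of_orderOf_dvd (hz.isOfFinOrder_iff.2 hy) (h'.symm ▸ dvd_rfl))

theorem ncard_generators {y : G} (hy : IsOfFinOrder y) :
    {z | zpowers z = zpowers y}.ncard = (orderOf y).totient := by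
  rw [← ncard_orderOf_eq_in_zpowers hy dvd_rfl]
  congr 1
  ext z
  exact zpowers_eq_iff_orderOf hy

theorem finite_generators {y : G} (hy : IsOfFinOrder y) :
    {z | zpowers z = zpowers y}.Finite :=
  (hy.finite_zpowers).subset fun z (hz : zpowers z = zpowers y) => by
    rw [SetLike.mem_coe, ← hz]; exact mem_zpowers z

theorem isOfFinOrder_of_zpowers_eq {y z : G} (h : zpowers z = zpowers y) (hy : IsOfFinOrder y) :
    IsOfFinOrder z :=
  (isNonzeroPower_of_zpowers_eq h hy).isOfFinOrder_iff.2 hy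

theorem twins_of_zpowers_eq {y z : G} (h : zpowers z = zpowers y) (hy : IsOfFinOrder y) :
    Twins z y :=
  (isNonzeroPower_of_zpowers_eq h hy).twins
    (isNonzeroPower_of_zpowers_eq h.symm (isOfFinOrder_of_zpowers_eq h hy))

end CyclicCounting

/-- Euler's theorem gives `4 ≡ 1` modulo the odd part, which therefore divides 3; the 2-part is at
most 4. -/
theorem dvd_twelve_of_totient_le_two {n : ℕ} (hn : 0 < n) (h : n.totient ≤ 2) : n ∣ 12 := by
  obtain ⟨a, m, hm, rfl⟩ := Nat.exists_eq_two_pow_mul_odd hn.ne'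
  have hc : Nat.Coprime (2 ^ a) m := Nat.Coprime.pow_left a (Nat.coprime_two_left.2 hm)
  rw [Nat.totient_mul hc] at h
  have h1 : 0 < (2 ^ a).totient := Nat.totient_pos.2 (by positivity)
  have h2 : 0 < m.totient := Nat.totient_pos.2 hm.pos
  have ha : (2 ^ a).totient ≤ 2 := by nlinarith
  have hm' : m.totient ≤ 2 := by nlinarith
  have h3 : m ∣ 3 := by
    have h4 := Nat.ModEq.pow_totient (n := m) (Nat.coprime_two_left.2 hm)
    have h5 : 2 ^ 2 ≡ 1 [MOD m] := by
      interval_cases m.totient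
      · simpa using h4.pow 2
      · exact h4
    simpa using (Nat.modEq_iff_dvd' (by norm_num)).1 h5.symm
  have h4 : 2 ^ a ∣ 2 ^ 2 := by
    apply pow_dvd_pow
    by_contra! h5
    obtain ⟨b, rfl⟩ : ∃ b, a = b + 2 + 1 := ⟨a - 3, by omega⟩
    rw [Nat.totient_prime_pow_succ Nat.prime_two] at ha
    have : 0 < 2 ^ b := by positivity
    rw [pow_add] at ha
    omega
  exact mul_dvd_mul h4 h3

/-! ### Power graph isomorphisms preserve torsion -/

section TorsionPreserved

variable {G : Type*} {H : Type*} [Group G] [Group H] {f : G ≃ H}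

/-- If `f x` were torsion, the whole torsion component of `H` would come from infinite-order
elements, whose twin classes have at most two members. Generators of a cyclic group are twins, so
all torsion orders of `H` would have totient at most 2 and divide 12. The infinite clique of the `x
^ (2 ^ k)` cannot be mapped into torsion of bounded order. -/
theorem PreservesLinked.not_isOfFinOrder_map (hf : PreservesLinked f) {x : G}
    (hx : ¬ IsOfFinOrder x) : ¬ IsOfFinOrder (f x) := by
  intro hfx
  have h1 : ∀ h : H, IsOfFinOrder h → ¬ IsOfFinOrder (f.symm h) := fun h hh hs => by
    have := hf.symm.commensurable (IsOfFinOrder.commensurable hh hfx)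
    rw [f.symm_apply_apply] at this
    exact hx (this.isOfFinOrder_iff.1 hs)
  have h2 : ∀ h : H, IsOfFinOrder h → orderOf h ∣ 12 := fun h hh => by
    refine dvd_twelve_of_totient_le_two hh.orderOf_pos ?_
    rw [← ncard_generators hh, ← Set.ncard_image_of_injective _ f.symm.injective]
    refine (Set.ncard_le_ncard ?_ (Set.toFinite {f.symm h, (f.symm h)⁻¹})).trans
      ((Set.ncard_insert_le _ _).trans (by simp))
    rintro _ ⟨z, hz, rfl⟩
    exact (hf.symm.twins_iff.2 (twins_of_zpowers_eq hz hh).symm).eq_or_eq_inv (h1 h hh)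
  have hT : ∀ k : ℕ, IsOfFinOrder (f (x ^ ((2 : ℤ) ^ k))) := fun k =>
    (hf.commensurable (zpow_isNonzeroPower x (pow_ne_zero k two_ne_zero)).commensurable
      ).isOfFinOrder_iff.2 hfx
  have hfinite : (Set.range fun k : ℕ => orderOf (f (x ^ ((2 : ℤ) ^ k)))).Finite :=
    (Nat.divisors 12).finite_toSet.subset (by
      rintro _ ⟨k, rfl⟩
      simpa using h2 _ (hT k))
  -- In a clique of bounded order, the finite cyclic group of a member of maximal order contains all
  -- the others.
  obtain ⟨_, ⟨⟨k₀, rfl⟩, hmax⟩⟩ := hfinite.exists_maximal (Set.range_nonempty _)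
  have hinj : Function.Injective fun k : ℕ => f (x ^ ((2 : ℤ) ^ k)) := by
    intro a b hab
    have := (zpow_left_inj hx).1 (f.injective hab)
    exact Nat.pow_right_injective le_rfl (by exact_mod_cast this)
  refine Set.infinite_range_of_injective hinj ((hT k₀).finite_zpowers.subset ?_)
  rintro _ ⟨k, rfl⟩
  have hl : Linked (f (x ^ ((2 : ℤ) ^ k))) (f (x ^ ((2 : ℤ) ^ k₀))) := by
    rw [hf, linked_zpow_zpow hx (pow_ne_zero _ two_ne_zero) (pow_ne_zero _ two_ne_zero)]
    exact (le_total k₀ k).imp (pow_dvd_pow _) (pow_dvd_pow _)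
  rcases hl with hl | hl
  · exact hl.mem_zpowers
  · have h5 := Nat.le_of_dvd (hT k).orderOf_pos hl.orderOf_dvd
    have h6 := hmax ⟨k, rfl⟩ h5
    exact (hl.of_orderOf_dvd (hT k₀) (by rw [le_antisymm h5 h6])).mem_zpowers

theorem PreservesLinked.isOfFinOrder_iff (hf : PreservesLinked f) (x : G) :
    IsOfFinOrder (f x) ↔ IsOfFinOrder x := by
  refine ⟨fun h => ?_, fun h => ?_⟩
  · by_contra hx
    exact hf.not_isOfFinOrder_map hx h
  · by_contra hx
    exact hf.symm.not_isOfFinOrder_map hx (by simpa using h)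

end TorsionPreserved

/-! ### Models of infinite-order components: integers and rationals -/

section Components

variable {G : Type*} {H : Type*} [Group G] [Group H]

/-- The components of `x` and `y` are isomorphic as directed power graphs. -/
def ComponentIso (x : G) (y : H) : Prop :=
  ∃ e : {z // Commensurable x z} ≃ {z // Commensurable y z},
    ∀ a b, (e a : H) ≼ e b ↔ (a : G) ≼ b

theorem exists_equiv_int_of_dominating {x : G} (hx : ¬ IsOfFinOrder x)
    (h : ¬ NonDominating x) :
    ∃ e : {n : ℤ // n ≠ 0} ≃ {z // Commensurable x z},
      ∀ a b, (e a : G) ≼ e b ↔ (b : ℤ) ∣ a := by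
  let e : {n : ℤ // n ≠ 0} → {z // Commensurable x z} := fun n =>
    ⟨x ^ (n : ℤ), (zpow_isNonzeroPower x n.2).commensurable.symm⟩
  refine ⟨Equiv.ofBijective e ⟨fun a b hab => ?_, fun z => ?_⟩, fun a b => ?_⟩
  · exact Subtype.ext ((zpow_left_inj hx).1 (congrArg Subtype.val hab))
  · obtain ⟨n, hn, hz⟩ := exists_zpow_of_dominating hx h z.2
    exact ⟨⟨n, hn⟩, Subtype.ext hz⟩
  · exact zpow_isNonzeroPower_zpow hx a.2

theorem componentIso_of_dominating {x : G} {y : H} (hx : ¬ IsOfFinOrder x)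
    (hxd : ¬ NonDominating x) (hy : ¬ IsOfFinOrder y) (hyd : ¬ NonDominating y) :
    ComponentIso x y := by
  obtain ⟨e, he⟩ := exists_equiv_int_of_dominating hx hxd
  obtain ⟨e', he'⟩ := exists_equiv_int_of_dominating hy hyd
  refine ⟨e.symm.trans e', fun a b => ?_⟩
  obtain ⟨a, rfl⟩ := e.surjective a
  obtain ⟨b, rfl⟩ := e.surjective b
  simp [he, he']

/-- Nonzero roots of elements in the component of `x` exist in that component and are unique. -/
structure HasUniqueRoots (x : G) : Prop where
  unique : ∀ y z : G, Commensurable x y → Commensurable x z → ∀ n : ℤ, n ≠ 0 → y ^ n = z ^ n → y = z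
  exists_root : ∀ y : G, Commensurable x y → ∀ n : ℤ, n ≠ 0 → ∃ z : G, z ^ n = y

/-- An element `z` with `z ^ m = x ^ n` goes to `n / m`. Infinite order makes this independent of
the exponents, uniqueness of roots makes it injective, and existence makes it surjective. -/
theorem HasUniqueRoots.exists_equiv_rat {x : G} (hx : ¬ IsOfFinOrder x) (h : HasUniqueRoots x) :
    ∃ e : {z // Commensurable x z} ≃ {q : ℚ // q ≠ 0},
      ∀ a b : {z // Commensurable x z}, (a : G) ≼ b ↔ ∃ k : ℤ, (e a : ℚ) = k * e b := by
  choose m n hm hn hmn using fun z : {z // Commensurable x z} => z.2.symm.exists_zpow_eq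
  have hm' : ∀ z, (m z : ℚ) ≠ 0 := fun z => by exact_mod_cast hm z
  have hn' : ∀ z, (n z : ℚ) ≠ 0 := fun z => by exact_mod_cast hn z
  have key : ∀ z : {z // Commensurable x z}, ∀ a b : ℤ, a ≠ 0 → (z : G) ^ a = x ^ b → (n z : ℚ) / m z = b / a := by
    intro z a b ha hab
    have h1 : x ^ (n z * a) = x ^ (b * m z) := by
      rw [zpow_mul, zpow_mul, ← hmn, ← hab, ← zpow_mul, ← zpow_mul, mul_comm]
    rw [div_eq_div_iff (hm' z) (by exact_mod_cast ha)]
    exact_mod_cast (zpow_left_inj hx).1 h1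
  let e : {z // Commensurable x z} → {q : ℚ // q ≠ 0} := fun z =>
    ⟨n z / m z, div_ne_zero (hn' z) (hm' z)⟩
  have hinj : Function.Injective e := by
    intro y z hyz
    have h1 : (n y : ℚ) / m y = n z / m z := congrArg Subtype.val hyz
    rw [div_eq_div_iff (hm' y) (hm' z)] at h1
    have h2 : n y * m z = n z * m y := by exact_mod_cast h1
    apply Subtype.ext
    refine h.unique y z y.2 z.2 (m y * m z) (mul_ne_zero (hm y) (hm z)) ?_
    rw [zpow_mul, hmn, mul_comm (m y), zpow_mul, hmn, ← zpow_mul, ← zpow_mul, h2]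
  refine ⟨Equiv.ofBijective e ⟨hinj, fun q => ?_⟩, fun a b => ?_⟩
  · have hq : (q : ℚ).num ≠ 0 := Rat.num_ne_zero.2 q.2
    have hd : ((q : ℚ).den : ℤ) ≠ 0 := by exact_mod_cast (q : ℚ).den_nz
    obtain ⟨z, hz⟩ := h.exists_root (x ^ (q : ℚ).num)
      (zpow_isNonzeroPower x hq).commensurable.symm (q : ℚ).den hd
    refine ⟨⟨z, commensurable_of_zpow_eq hq hd hz.symm⟩, Subtype.ext ?_⟩
    refine (key _ _ _ hd hz).trans ?_
    exact_mod_cast Rat.num_div_den (q : ℚ)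
  · have h3 : ∀ k : ℤ, k ≠ 0 → ((b : G) ^ k = a ↔ (e a : ℚ) = k * e b) := by
      intro k hk
      have hc : Commensurable x ((b : G) ^ k) :=
        b.2.trans (zpow_isNonzeroPower _ hk).commensurable.symm
      have h4 : (e ⟨(b : G) ^ k, hc⟩ : ℚ) = k * e b := by
        have h6 : ((b : G) ^ k) ^ m b = x ^ (k * n b) := by
          rw [← zpow_mul, mul_comm, zpow_mul, hmn, ← zpow_mul, mul_comm]
        refine (key _ _ _ (hm b) h6).trans ?_
        push_cast
        exact mul_div_assoc _ _ _
      rw [← h4]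
      constructor
      · intro h5
        congr 2
        exact Subtype.ext h5.symm
      · intro h5
        exact congrArg Subtype.val (hinj (Subtype.ext h5)).symm
    constructor
    · rintro ⟨k, hk, h4⟩
      exact ⟨k, (h3 k hk).1 h4⟩
    · rintro ⟨k, hk⟩
      have hk0 : k ≠ 0 := by
        rintro rfl
        exact (e a).2 (hk.trans (by simp))
      exact ⟨k, hk0, (h3 k hk0).2 hk⟩

theorem HasUniqueRoots.componentIso {x : G} {y : H} (hx : ¬ IsOfFinOrder x)
    (hxr : HasUniqueRoots x) (hy : ¬ IsOfFinOrder y) (hyr : HasUniqueRoots y) :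
    ComponentIso x y := by
  obtain ⟨e, he⟩ := hxr.exists_equiv_rat hx
  obtain ⟨e', he'⟩ := hyr.exists_equiv_rat hy
  refine ⟨e.trans e'.symm, fun a b => ?_⟩
  rw [he, he']
  simp

end Components

/-! ### Reversed components, and gluing the components -/

section Components

variable {G : Type*} {H : Type*} [Group G] [Group H] {f : G ≃ H}

/-- The images have a common nonzero power, and reversal turns its preimage into a common root. -/
theorem common_root_of_reverses (hf : PreservesLinked f) {x₀ : G}
    (h : ∀ x y, Commensurable x₀ x → Commensurable x₀ y → (f x ≼ f y ↔ y ≼ x)) {y z : G}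
    (hy : Commensurable x₀ y) (hz : Commensurable x₀ z) : ∃ u, y ≼ u ∧ z ≼ u := by
  obtain ⟨w, hwy, hwz⟩ := hf.commensurable (hy.symm.trans hz)
  obtain ⟨u, rfl⟩ := f.surjective w
  have hu : Commensurable x₀ u :=
    hy.trans (hf.commensurable_iff.1 hwy.commensurable.symm)
  exact ⟨u, (h u y hu hy).1 hwy, (h u z hu hz).1 hwz⟩

/-- Reversal turns the prime step from `z ^ p` up to `z` into a prime step `f z = v ^ k` down from
`v = f (z ^ p)`. Going down once more by `k` reaches some `f u`, and `u` is the root sought, up to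
inversion. -/
theorem exists_prime_root_of_reverses (hf : PreservesLinked f) {x₀ : G}
    (hx₀ : ¬ IsOfFinOrder x₀)
    (h : ∀ x y, Commensurable x₀ x → Commensurable x₀ y → (f x ≼ f y ↔ y ≼ x)) {z : G}
    (hz : Commensurable x₀ z) {p : ℕ} (hp : p.Prime) : ∃ u : G, u ^ (p : ℤ) = z := by
  have hp0 : (p : ℤ) ≠ 0 := by exact_mod_cast hp.ne_zero
  have hp1 : ¬ (p : ℤ) ∣ 1 := fun h' => hp.one_lt.ne' (Nat.dvd_one.1 (by exact_mod_cast h'))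
  have hmem : ∀ {u w : G}, Commensurable x₀ u → Linked u w → Commensurable x₀ w :=
    fun hu hw => hu.trans hw.commensurable
  have hinf : ∀ {u}, Commensurable x₀ u → ¬ IsOfFinOrder u := fun hu hu' =>
    hx₀ (hu.isOfFinOrder_iff.2 hu')
  have hzp : Commensurable x₀ (z ^ (p : ℤ)) := hmem hz (Or.inr (zpow_isNonzeroPower z hp0))
  have hpz : ∀ {u : G}, Commensurable x₀ u → ¬ u ≼ u ^ (p : ℤ) := fun {u} hu h' => by
    rw [← zpow_one u, ← zpow_mul, zpow_isNonzeroPower_zpow (hinf hu) one_ne_zero, one_mul] at h'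
    exact hp1 h'
  obtain ⟨k, hk0, hk⟩ := (h z _ hz hzp).2 (zpow_isNonzeroPower z hp0)
  set v := f (z ^ (p : ℤ)) with hv
  have hvi : ¬ IsOfFinOrder v := by rw [hv, hf.isOfFinOrder_iff]; exact hinf hzp
  -- Divisors of `k` give elements between `f z` and `v`, hence between `z ^ p` and `z`, where `p`
  -- leaves no room.
  have hkprime : k.natAbs.Prime := by
    rw [Nat.prime_def]
    constructor
    · by_contra hlt
      have hku : k.natAbs = 1 := by have := Int.natAbs_pos.2 hk0; omega
      refine hpz hz ((h _ _ hzp hz).1 ?_)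
      rw [← hv, ← hk, ← zpow_one v, ← zpow_mul, one_mul, zpow_isNonzeroPower_zpow hvi one_ne_zero]
      exact Int.natAbs_dvd_natAbs.1 (by simp [hku])
    · intro a ha
      have ha' : (a : ℤ) ∣ k := Int.natCast_dvd.2 ha
      have ha0 : (a : ℤ) ≠ 0 := fun h0 => hk0 (by simpa [h0] using ha')
      obtain ⟨t, ht⟩ := f.surjective (v ^ (a : ℤ))
      have h1 : f z ≼ f t := by rw [← hk, ht, zpow_isNonzeroPower_zpow hvi hk0]; exact ha'
      have h2 : f t ≼ v := by rw [ht]; exact zpow_isNonzeroPower v ha0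
      have htm : Commensurable x₀ t := hmem hz ((hf _ _).1 (Or.inl h1))
      obtain ⟨e, he0, rfl⟩ := (h z t hz htm).1 h1
      have h3 := (h _ _ htm hzp).1 h2
      rw [zpow_isNonzeroPower_zpow (hinf hz) hp0] at h3
      rcases (Nat.dvd_prime hp).1 (by simpa using Int.natAbs_dvd_natAbs.2 h3) with h4 | h4
      · right
        have h5 : f (z ^ e) ≼ f z := by
          rw [h _ _ htm hz, ← zpow_one z, ← zpow_mul, zpow_isNonzeroPower_zpow (hinf hz) one_ne_zero]
          exact Int.natAbs_dvd_natAbs.1 (by simp [h4])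
        rw [ht, ← hk, zpow_isNonzeroPower_zpow hvi ha0] at h5
        exact Nat.dvd_antisymm ha (by simpa using Int.natAbs_dvd_natAbs.2 h5)
      · left
        have h5 : v ≼ f (z ^ e) := by
          rw [hv, h _ _ hzp htm, zpow_isNonzeroPower_zpow (hinf hz) he0]
          exact Int.natAbs_dvd_natAbs.1 (by simp [h4])
        rw [ht, ← zpow_one v, ← zpow_mul, zpow_isNonzeroPower_zpow hvi one_ne_zero] at h5
        simpa using Int.natAbs_dvd_natAbs.2 h5
  have hkk : k * k ≠ 0 := mul_ne_zero hk0 hk0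
  obtain ⟨u, hu⟩ := f.surjective (v ^ (k * k))
  have hfu : f u ≼ f z := by
    rw [hu, ← hk, zpow_isNonzeroPower_zpow hvi hkk]; exact dvd_mul_right k k
  have hum : Commensurable x₀ u := hmem hz ((hf _ _).1 (Or.inr hfu))
  have hup : Commensurable x₀ (u ^ (p : ℤ)) := hmem hum (Or.inr (zpow_isNonzeroPower u hp0))
  obtain ⟨j, hj0, rfl⟩ := (h _ _ hum hz).1 hfu
  have hpj : (u ^ j) ^ (p : ℤ) ≼ u ^ (p : ℤ) := ⟨j, hj0, by rw [← zpow_mul, ← zpow_mul, mul_comm]⟩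
  obtain ⟨d, hd0, hd⟩ := (h _ _ hup hzp).2 hpj
  rw [← hv] at hd
  have hdk : d ∣ k * k := by
    rw [← zpow_isNonzeroPower_zpow hvi hkk, ← hu, hd, h _ _ hum hup]
    exact zpow_isNonzeroPower u hp0
  have hmut : ∀ {w : G} {c : ℤ}, c ≠ 0 → f w = v ^ c → d.natAbs = c.natAbs →
      u ^ (p : ℤ) ≼ w ∧ w ≼ u ^ (p : ℤ) := fun {w c} hc hw hdc => by
    apply mutual_of_map_mutual hf (hinf hup)
    · rw [hw, ← hd, zpow_isNonzeroPower_zpow hvi hd0]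
      exact Int.natAbs_dvd_natAbs.1 hdc.symm.dvd
    · rw [hw, ← hd, zpow_isNonzeroPower_zpow hvi hc]
      exact Int.natAbs_dvd_natAbs.1 hdc.dvd
  have hd' : d.natAbs ∣ k.natAbs ^ 2 := by
    rw [sq, ← Int.natAbs_mul]; exact Int.natAbs_dvd_natAbs.2 hdk
  obtain ⟨i, hi, hdi⟩ := (Nat.dvd_prime_pow hkprime).1 hd'
  -- Here `f (u ^ p) = v ^ d`. If `|d| = 1`, then `u ^ p` and `z ^ p` are mutual powers, so `z` and
  -- `u` are too, against `f u = f z ^ k`. If `|d| = k ^ 2`, then `u` would be a power of `u ^ p`.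
  -- So `|d| = |k|`, and `u ^ p` is `z` or its inverse.
  interval_cases i
  · have h5 := (hmut one_ne_zero (by rw [zpow_one]) (by simpa using hdi)).1
    rw [← zpow_mul, zpow_isNonzeroPower_zpow (hinf hum) hp0] at h5
    have hj1 : j ∣ 1 := by
      obtain ⟨c, hc⟩ := h5
      exact ⟨c, mul_left_cancel₀ hp0 (by linarith)⟩
    have h6 : f (u ^ j) ≼ f u := by
      rw [h _ _ hz hum]
      refine ⟨j, hj0, ?_⟩
      rw [← zpow_mul]
      rcases Int.isUnit_iff.1 (isUnit_of_dvd_one hj1) with rfl | rfl <;> simp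
    rw [← hk, hu, zpow_isNonzeroPower_zpow hvi hk0] at h6
    have h7 : k * k ∣ k * 1 := by simpa using h6
    have h8 := (mul_dvd_mul_iff_left hk0).1 h7
    exact absurd (by simpa using Int.natAbs_dvd_natAbs.2 h8) hkprime.one_lt.ne'
  · have h5 := hmut hk0 hk.symm (by simpa using hdi)
    rcases h5.1.eq_or_eq_inv (hinf hup) h5.2 with h6 | h6
    · exact ⟨u, h6.symm⟩
    · exact ⟨u⁻¹, by rw [inv_zpow, h6]⟩
  · exact absurd (hmut hkk hu (by rw [hdi, Int.natAbs_mul, sq])).2 (hpz hum)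

/-- Two elements with equal `n`-th powers are powers of a common root, where exponents can be
compared. Existence reduces to prime exponents by multiplicativity. -/
theorem hasUniqueRoots_of_reverses (hf : PreservesLinked f) {x₀ : G} (hx₀ : ¬ IsOfFinOrder x₀)
    (h : ∀ x y, Commensurable x₀ x → Commensurable x₀ y → (f x ≼ f y ↔ y ≼ x)) :
    HasUniqueRoots x₀ where
  unique y z hy hz n hn hyz := by
    obtain ⟨u, ⟨a, ha, rfl⟩, ⟨b, hb, rfl⟩⟩ := common_root_of_reverses hf h hy hz
    have hu : ¬ IsOfFinOrder u := fun hu => hx₀ (hy.isOfFinOrder_iff.2 hu.zpow)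
    rw [← zpow_mul, ← zpow_mul, zpow_left_inj hu] at hyz
    rw [mul_right_cancel₀ hn hyz]
  exists_root := by
    have hnat : ∀ n : ℕ, n ≠ 0 → ∀ y : G, Commensurable x₀ y → ∃ z : G, z ^ (n : ℤ) = y := by
      intro n
      induction n using Nat.recOnMul with
      | zero => exact fun h => absurd rfl h
      | one => exact fun _ y _ => ⟨y, by simp⟩
      | prime p hp => exact fun _ y hy => exists_prime_root_of_reverses hf hx₀ h hy hp
      | mul a b iha ihb =>
        intro hab y hy
        obtain ⟨z, rfl⟩ := iha (left_ne_zero_of_mul hab) y hy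
        obtain ⟨w, rfl⟩ := ihb (right_ne_zero_of_mul hab) z (hy.trans
          (zpow_isNonzeroPower z (by exact_mod_cast left_ne_zero_of_mul hab)).commensurable)
        exact ⟨w, by push_cast; rw [mul_comm, zpow_mul]⟩
    intro y hy n hn
    obtain ⟨z, hz⟩ := hnat n.natAbs (Int.natAbs_ne_zero.2 hn) y hy
    rcases Int.natAbs_eq n with h' | h'
    · exact ⟨z, by rw [h', hz]⟩
    · exact ⟨z⁻¹, by rw [h', inv_zpow, zpow_neg, inv_inv, hz]⟩

theorem ComponentIso.congr {x x' : G} {y y' : H} (hx : Commensurable x x')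
    (hy : Commensurable y y') (h : ComponentIso x y) : ComponentIso x' y' := by
  obtain ⟨e, he⟩ := h
  refine ⟨((Equiv.subtypeEquivRight fun z => ⟨hx.trans, hx.symm.trans⟩).trans e).trans
    (Equiv.subtypeEquivRight fun z => ⟨hy.symm.trans, hy.trans⟩), fun a b => ?_⟩
  exact he ⟨a, hx.trans a.2⟩ ⟨b, hx.trans b.2⟩

theorem PreservesLinked.nonDominating_iff (hf : PreservesLinked f) {x : G} :
    NonDominating (f x) ↔ NonDominating x := by
  constructor
  · rintro ⟨w, hw, hl⟩
    obtain ⟨w, rfl⟩ := f.surjective w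
    exact ⟨w, hf.commensurable_iff.1 hw, fun h => hl ((hf _ _).2 h)⟩
  · rintro ⟨w, hw, hl⟩
    exact ⟨f w, hf.commensurable hw, fun h => hl ((hf _ _).1 h)⟩

/-- Both alternatives to preservation produce common roots: a reversal does, and so does a
dominating element, of which everything in the component is a power. -/
theorem preserves_of_no_common_root (hf : PreservesLinked f) {x y : G} (hx : ¬ IsOfFinOrder x)
    (hxy : Commensurable x y) (hr : ¬ ∃ u, x ≼ u ∧ y ≼ u) :
    ∀ a b, Commensurable x a → Commensurable x b → (f a ≼ f b ↔ a ≼ b) := by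
  have hnd : ∀ z, Commensurable x z → NonDominating z := fun z hz => by
    by_contra hz'
    have hzi := fun k => hx (hz.isOfFinOrder_iff.2 k)
    exact hr ⟨z, exists_zpow_of_dominating hzi hz' hz.symm,
      exists_zpow_of_dominating hzi hz' (hz.symm.trans hxy)⟩
  refine (preserves_or_reverses hf hf.isOfFinOrder_iff hx hnd).resolve_right fun h => hr ?_
  exact common_root_of_reverses hf h (.refl x) hxy

theorem componentIso_of_not_isOfFinOrder (hf : PreservesLinked f) {x : G}
    (hx : ¬ IsOfFinOrder x) : ComponentIso x (f x) := by
  have hi : ∀ {z}, Commensurable x z → ¬ IsOfFinOrder z := fun h h' =>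
    hx (h.isOfFinOrder_iff.2 h')
  by_cases hnd : ∀ y, Commensurable x y → NonDominating y
  · rcases preserves_or_reverses hf hf.isOfFinOrder_iff hx hnd with h | h
    · exact ⟨f.subtypeEquiv fun z => hf.commensurable_iff.symm, fun a b => h a b a.2 b.2⟩
    · refine (hasUniqueRoots_of_reverses hf hx h).componentIso hx
        (by rwa [hf.isOfFinOrder_iff])
        (hasUniqueRoots_of_reverses hf.symm (by rwa [hf.isOfFinOrder_iff]) fun a b ha hb => ?_)
      have ha' := hf.symm.commensurable ha
      have hb' := hf.symm.commensurable hb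
      rw [f.symm_apply_apply] at ha' hb'
      simpa using (h _ _ hb' ha').symm
  · push Not at hnd
    obtain ⟨y, hxy, hy⟩ := hnd
    exact (componentIso_of_dominating (hi hxy) hy (by rw [hf.isOfFinOrder_iff]; exact hi hxy)
      (by rwa [hf.nonDominating_iff])).congr hxy.symm (hf.commensurable hxy.symm)

/-- One representative is chosen in each component and its isomorphism used throughout that
component; `f` guarantees that distinct components have distinct targets and that all are reached.
-/
theorem exists_equiv_of_componentIso (hf : PreservesLinked f)
    (h : ∀ x, ComponentIso x (f x)) : ∃ g : G ≃ H, ∀ a b, g a ≼ g b ↔ a ≼ b := by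
  let s := commensurableSetoid G
  choose e he using fun c : Quotient s => h c.out
  have hout : ∀ x : G, Commensurable (Quotient.mk s x).out x := fun x => Quotient.mk_out (s := s) x
  let g : G → H := fun x => e (Quotient.mk s x) ⟨x, hout x⟩
  have hg : ∀ (x : G) (c : Quotient s) (hc : Commensurable c.out x), g x = e c ⟨x, hc⟩ := by
    intro x c hc
    have : c = Quotient.mk s x := by
      rw [← Quotient.out_eq c]
      exact Quotient.sound hc
    subst this
    rfl
  have hgc : ∀ x, Commensurable (f x) (g x) := fun x =>
    (hf.commensurable (hout x).symm).trans (e (Quotient.mk s x) ⟨x, hout x⟩).2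
  have hsame : ∀ {x y}, Commensurable (g x) (g y) → Commensurable x y := fun {x y} hxy =>
    hf.commensurable_iff.1 ((hgc x).trans (hxy.trans (hgc y).symm))
  refine ⟨Equiv.ofBijective g ⟨fun x y hxy => ?_, fun y => ?_⟩, fun a b => ?_⟩
  · have hc : Commensurable x y := hsame (by rw [hxy]; exact .refl _)
    rw [hg x _ (hout x), hg y _ ((hout x).trans hc)] at hxy
    simpa using (e _).injective (Subtype.ext hxy)
  · obtain ⟨x, rfl⟩ := f.surjective y
    have hy := hf.commensurable (hout x)
    obtain ⟨z, hz⟩ := (e (Quotient.mk s x)).surjective ⟨f x, hy⟩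
    exact ⟨z, by rw [hg _ _ z.2, hz]⟩
  · change g a ≼ g b ↔ a ≼ b
    constructor
    · intro hab
      have hc := hsame hab.commensurable
      rw [hg a _ (hout a), hg b _ ((hout a).trans hc), he] at hab
      exact hab
    · intro hab
      rw [hg a _ (hout a), hg b _ ((hout a).trans hab.commensurable), he]
      exact hab

end Components

/-! ### Commutation in nilpotent groups -/

section Nilpotent

/-- Each `a` moved past `b` costs one central factor. With `c = ⁅a, b⁆` this is the bilinearity of a
central commutator, used in the inductions on the central quotient below. -/
theorem pow_mul_eq_of_central {G : Type*} [Group G] {a b c : G} (hc : c ∈ center G)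
    (h : a * b = c * (b * a)) (k : ℕ) : a ^ k * b = c ^ k * (b * a ^ k) := by
  have hc' : ∀ g, g * c = c * g := mem_center_iff.1 hc
  induction k with
  | zero => simp
  | succ k ih =>
    calc a ^ (k + 1) * b = a ^ k * (a * b) := by rw [pow_succ, mul_assoc]
      _ = (a ^ k * c) * (b * a) := by rw [h]; group
      _ = c * (a ^ k * b) * a := by rw [hc']; group
      _ = c ^ (k + 1) * (b * a ^ (k + 1)) := by rw [ih, pow_succ' c, pow_succ a]; group

theorem mul_pow_eq_of_central {G : Type*} [Group G] {a b c : G} (hc : c ∈ center G)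
    (h : a * b = c * (b * a)) (k : ℕ) : a * b ^ k = c ^ k * (b ^ k * a) := by
  have hc' : ∀ g, g * c⁻¹ = c⁻¹ * g := mem_center_iff.1 (inv_mem hc)
  have := pow_mul_eq_of_central (a := b) (b := a) (inv_mem hc) (by rw [h]; group) k
  rw [this, inv_pow]
  group

theorem mul_eq_commutator_mul {G : Type*} [Group G] (a b : G) : a * b = ⁅a, b⁆ * (b * a) := by
  rw [commutatorElement_def]; group

theorem commute_iff_commutator {G : Type*} [Group G] {a b : G} : Commute a b ↔ ⁅a, b⁆ = 1 :=
  commutatorElement_eq_one_iff_commute.symm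

theorem commutator_mem_center {G : Type*} [Group G] {a b : G}
    (h : Commute (a : G ⧸ center G) (b : G ⧸ center G)) : ⁅a, b⁆ ∈ center G := by
  rw [commute_iff_commutator] at h
  exact (QuotientGroup.eq_one_iff _).1 h

/-- By induction modulo the centre, the commutator is central, and by bilinearity it is killed by
both `m` and `n`. -/
theorem commute_of_coprime (G : Type*) [Group G] [Group.IsNilpotent G] :
    ∀ (a b : G) (m n : ℕ), m.Coprime n → a ^ m = 1 → b ^ n = 1 → Commute a b := by
  apply @Group.nilpotent_center_quotient_ind _ G _ _ <;> clear! G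
  · intro G _ _; exact fun a b _ _ _ _ _ => Subsingleton.elim _ _
  · intro G _ _ ih a b m n hmn ha hb
    have hc := commutator_mem_center (ih a b m n hmn
      (by rw [← QuotientGroup.mk_pow, ha]; rfl) (by rw [← QuotientGroup.mk_pow, hb]; rfl))
    have h1 := pow_mul_eq_of_central hc (mul_eq_commutator_mul a b) m
    have h2 := mul_pow_eq_of_central hc (mul_eq_commutator_mul a b) n
    rw [ha, one_mul, mul_one, right_eq_mul] at h1
    rw [hb, one_mul, mul_one, right_eq_mul] at h2
    rw [commute_iff_commutator, ← orderOf_eq_one_iff]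
    exact Nat.eq_one_of_dvd_coprimes hmn (orderOf_dvd_of_pow_eq_one h1) (orderOf_dvd_of_pow_eq_one h2)

/-- Writing `x = y ^ (r ^ k)` with `y ∈ S`, and with `⁅y, g⁆` central by induction, the exponent can
be moved onto `g`, which it kills. -/
theorem commute_of_divisible (G : Type*) [Group G] [Group.IsNilpotent G] (r : ℕ) :
    ∀ S : Set G, (∀ x ∈ S, ∃ y ∈ S, y ^ r = x) → ∀ g : G, ∀ k : ℕ, g ^ r ^ k = 1 →
      ∀ x ∈ S, Commute x g := by
  apply @Group.nilpotent_center_quotient_ind _ G _ _ <;> clear! G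
  · intro G _ _; exact fun _ _ _ _ _ _ _ => Subsingleton.elim _ _
  · intro G _ _ ih S hS g k hg
    have hk : ∀ k : ℕ, ∀ x ∈ S, ∃ y ∈ S, y ^ r ^ k = x := by
      intro k
      induction k with
      | zero => exact fun x hx => ⟨x, hx, by simp⟩
      | succ k ihk =>
        intro x hx
        obtain ⟨y, hy, rfl⟩ := ihk x hx
        obtain ⟨z, hz, rfl⟩ := hS y hy
        exact ⟨z, hz, by rw [pow_succ', pow_mul]⟩
    intro x hx
    obtain ⟨y, hy, rfl⟩ := hk k x hx
    have hc := commutator_mem_center (ih ((↑) '' S) (by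
      rintro _ ⟨x, hx, rfl⟩
      obtain ⟨y, hy, rfl⟩ := hS x hx
      exact ⟨y, ⟨y, hy, rfl⟩, rfl⟩) g k (by rw [← QuotientGroup.mk_pow, hg]; rfl) y ⟨y, hy, rfl⟩)
    have h1 := pow_mul_eq_of_central hc (mul_eq_commutator_mul y g) (r ^ k)
    have h2 := mul_pow_eq_of_central hc (mul_eq_commutator_mul y g) (r ^ k)
    rw [hg, one_mul, mul_one, right_eq_mul] at h2
    rwa [h2, one_mul] at h1

/-- By induction and normality `⁅y, g⁆` is central and lies in `P`; take `y` to be a root of `x` of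
exponent the order of `x`. Either `x` is a power of this central element, or `⁅y, g⁆` lies in the
group of `x`, is killed by the order of `x`, and so `x` commutes with `g`. -/
theorem le_center_of_chain (G : Type*) [Group G] [Group.IsNilpotent G] :
    ∀ P : Subgroup G, P.Normal → (∀ x ∈ P, ∀ y ∈ P, x ∈ zpowers y ∨ y ∈ zpowers x) →
      (∀ x ∈ P, IsOfFinOrder x) → (∀ x ∈ P, ∀ n : ℕ, 0 < n → ∃ y ∈ P, y ^ n = x) →
      P ≤ center G := by
  apply @Group.nilpotent_center_quotient_ind _ G _ _ <;> clear! G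
  · intro G _ _; exact fun _ _ _ _ _ _ _ => mem_center_iff.2 fun _ => Subsingleton.elim _ _
  · intro G _ _ ih P hP hchain hfin hdiv x hx
    refine mem_center_iff.2 fun g => ?_
    have hmap := ih (P.map (QuotientGroup.mk' (center G)))
      (hP.map _ (QuotientGroup.mk'_surjective _))
      (by
        rintro _ ⟨x, hx, rfl⟩ _ ⟨y, hy, rfl⟩
        rw [← MonoidHom.map_zpowers, ← MonoidHom.map_zpowers]
        exact (hchain x hx y hy).imp (mem_map_of_mem _) (mem_map_of_mem _))
      (by
        rintro _ ⟨x, hx, rfl⟩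
        exact MonoidHom.isOfFinOrder _ (hfin x hx))
      (by
        rintro _ ⟨x, hx, rfl⟩ n hn
        obtain ⟨y, hy, rfl⟩ := hdiv x hx n hn
        exact ⟨_, mem_map_of_mem _ hy, (map_pow _ _ _).symm⟩)
    have hc : ∀ y ∈ P, ⁅y, g⁆ ∈ center G := fun y hy => commutator_mem_center
      (mem_center_iff.1 (hmap (mem_map_of_mem _ hy)) (g : G ⧸ center G)).symm
    have hcP : ∀ y ∈ P, ⁅y, g⁆ ∈ P := fun y hy => by
      rw [commutatorElement_def, mul_assoc, mul_assoc, ← mul_assoc g]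
      exact mul_mem hy (hP.conj_mem _ (inv_mem hy) g)
    obtain ⟨y, hy, hyx⟩ := hdiv x hx (orderOf x) (hfin x hx).orderOf_pos
    have h1 := pow_mul_eq_of_central (hc y hy) (mul_eq_commutator_mul y g) (orderOf x)
    rcases hchain x hx _ (hcP y hy) with h | h
    · exact mem_center_iff.1 (zpowers_le.2 (hc y hy) h) g
    · have h2 : ⁅y, g⁆ ^ orderOf x = 1 :=
        orderOf_dvd_iff_pow_eq_one.1 (orderOf_dvd_of_mem_zpowers h)
      rw [hyx, h2, one_mul] at h1
      exact h1.symm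

/-- Induction on the upper central term containing `b`: the commutator `d` of `a` and `b` lies one
term lower and commutes with `a ^ n`, hence with `a`. Then `d ^ n = 1`, and torsion-freeness gives
`d = 1`. -/
theorem commute_of_commute_pow {G : Type*} [Group G] [Group.IsNilpotent G]
    (htf : ∀ x : G, IsOfFinOrder x → x = 1) {a b : G} {n : ℕ} (hn : 0 < n)
    (h : Commute (a ^ n) b) : Commute a b := by
  have key : ∀ i : ℕ, ∀ b ∈ Subgroup.upperCentralSeries G i, Commute (a ^ n) b → Commute a b := by
    intro i
    induction i with
    | zero =>
      intro b hb _
      rw [Subgroup.upperCentralSeries_zero, mem_bot] at hb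
      rw [hb]; exact Commute.one_right a
    | succ i ih =>
      intro b hb hab
      set d := a * b * a⁻¹ * b⁻¹ with hd
      have hdi : d ∈ Subgroup.upperCentralSeries G i := by
        have := inv_mem (Subgroup.mem_upperCentralSeries_succ_iff.1 hb a)
        rwa [commutatorElement_inv, commutatorElement_def] at this
      have hda : Commute a d := ih d hdi
        ((((Commute.refl a).pow_left n).mul_right hab).mul_right
          ((Commute.refl a).pow_left n).inv_right |>.mul_right hab.inv_right)
      have h1 : ∀ k : ℕ, a ^ k * b = d ^ k * b * a ^ k := by
        intro k
        induction k with
        | zero => simp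
        | succ k ihk =>
          have h2 : a * b = d * b * a := by rw [hd]; group
          calc a ^ (k + 1) * b = a * (a ^ k * b) := by rw [pow_succ', mul_assoc]
            _ = (a * d ^ k) * b * a ^ k := by rw [ihk]; group
            _ = d ^ k * (a * b) * a ^ k := by rw [(hda.pow_right k).eq]; group
            _ = d ^ (k + 1) * b * a ^ (k + 1) := by rw [h2, pow_succ d, pow_succ' a]; group
      have h3 := h1 n
      rw [hab.eq, mul_left_inj, right_eq_mul] at h3
      have h4 : d = 1 := htf d (isOfFinOrder_iff_pow_eq_one.2 ⟨n, hn, h3⟩)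
      have h5 := h1 1
      simpa [h4, Commute, SemiconjBy] using h5
  obtain ⟨i, hi⟩ := Group.IsNilpotent.nilpotent G
  exact key i b (by rw [hi]; trivial) h

end Nilpotent

/-- For a prime `r` dividing `n / m`, the full `r`-part of `n` does not divide `m`, so `m` divides
it and is a power of `r`. Any other prime factor of `n` would be incomparable with `m`. -/
theorem eq_prime_pow_of_dvd_total {m n : ℕ} (hn : 0 < n) (hmn : m ∣ n) (hne : m ≠ n) (h1 : m ≠ 1)
    (h : ∀ d, d ∣ n → d ∣ m ∨ m ∣ d) : ∃ r i j, r.Prime ∧ m = r ^ i ∧ n = r ^ j := by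
  obtain ⟨c, rfl⟩ := hmn
  have hm0 : m ≠ 0 := by rintro rfl; simp at hn
  have hc0 : c ≠ 0 := by rintro rfl; simp at hn
  have hc1 : c ≠ 1 := by rintro rfl; simp at hne
  obtain ⟨r, hr, hrc⟩ := Nat.exists_prime_and_dvd hc1
  have hnot : ¬ r ^ (m * c).factorization r ∣ m := by
    rw [hr.pow_dvd_iff_le_factorization hm0, Nat.factorization_mul hm0 hc0, Finsupp.add_apply]
    have := hr.factorization_pos_of_dvd hc0 hrc
    omega
  obtain ⟨i, -, hi⟩ := (Nat.dvd_prime_pow hr).1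
    ((h _ (Nat.ordProj_dvd (m * c) r)).resolve_left hnot)
  have hi0 : i ≠ 0 := by rintro rfl; exact h1 (by simpa using hi)
  refine ⟨r, i, _, hr, hi, Nat.eq_prime_pow_of_unique_prime_dvd hn.ne' fun {s} hs hsn => ?_⟩
  rcases h s hsn with h' | h'
  · rw [hi] at h'
    exact (Nat.prime_dvd_prime_iff_eq hs hr).1 (hs.dvd_of_dvd_pow h')
  · have : r ∣ s := (hi ▸ dvd_pow_self r hi0 : r ∣ m).trans h'
    exact ((Nat.prime_dvd_prime_iff_eq hr hs).1 this).symm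

/-! ### Torsion with two prime orders: twins and dominating elements -/

section OneGroup

variable {G : Type*} [Group G]

theorem exists_mem_zpowers_orderOf_eq {y : G} (hy : IsOfFinOrder y) {d : ℕ}
    (hd : d ∣ orderOf y) : ∃ z ∈ zpowers y, orderOf z = d := by
  obtain ⟨c, hc⟩ := hd
  have h0 := hy.orderOf_pos
  have hc0 : c ≠ 0 := by rintro rfl; omega
  refine ⟨y ^ c, pow_mem (mem_zpowers y) c, ?_⟩
  rw [orderOf_pow_of_dvd hc0 (hc ▸ dvd_mul_left c d), hc, Nat.mul_div_cancel _ (by omega)]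

theorem Linked.orderOf_dvd_or {x y : G} (h : Linked x y) :
    orderOf x ∣ orderOf y ∨ orderOf y ∣ orderOf x :=
  h.imp (·.orderOf_dvd) (·.orderOf_dvd)

theorem exists_prime_pow_of_powers_linked {x y : G} (hy : IsOfFinOrder y) (hxy : x ≼ y)
    (hyx : ¬ y ≼ x) (hx1 : x ≠ 1) (h : ∀ z ∈ zpowers y, Linked z x) :
    ∃ r i j, r.Prime ∧ orderOf x = r ^ i ∧ orderOf y = r ^ j := by
  have hx := hxy.isOfFinOrder_iff.2 hy
  refine eq_prime_pow_of_dvd_total hy.orderOf_pos hxy.orderOf_dvd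
    (fun h' => hyx (hxy.of_orderOf_dvd hx h'.symm.dvd)) (by rwa [ne_eq, orderOf_eq_one_iff])
    fun d hd => ?_
  obtain ⟨z, hz, rfl⟩ := exists_mem_zpowers_orderOf_eq hy hd
  exact (h z hz).orderOf_dvd_or

/-- All torsion elements have order a power of `r`. -/
def TorsionIsPrimary (r : ℕ) (G : Type*) [Group G] : Prop :=
  ∀ x : G, IsOfFinOrder x → ∃ k, orderOf x = r ^ k

/-- There are elements of two different prime orders. -/
def HasTwoPrimeOrders (G : Type*) [Group G] : Prop :=
  ∃ z w : G, (orderOf z).Prime ∧ (orderOf w).Prime ∧ orderOf z ≠ orderOf w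

theorem primary_or_hasTwoPrimeOrders (G : Type*) [Group G] :
    (∃ r, r.Prime ∧ TorsionIsPrimary r G) ∨ HasTwoPrimeOrders G := by
  by_contra! h
  obtain ⟨h1, h2⟩ := h
  have h3 : ∀ x y : G, IsOfFinOrder x → IsOfFinOrder y → ∀ p q : ℕ, p.Prime → q.Prime →
      p ∣ orderOf x → q ∣ orderOf y → p = q := by
    intro x y hx hy p q hp hq hpx hqy
    obtain ⟨z, -, rfl⟩ := exists_mem_zpowers_orderOf_eq hx hpx
    obtain ⟨w, -, rfl⟩ := exists_mem_zpowers_orderOf_eq hy hqy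
    by_contra hne
    exact h2 ⟨z, w, hp, hq, hne⟩
  have h4 := h1 2 Nat.prime_two
  simp only [TorsionIsPrimary, not_forall] at h4
  obtain ⟨x, hx, hx2⟩ := h4
  have hx1 : orderOf x ≠ 1 := fun h => hx2 ⟨0, by simpa using h⟩
  obtain ⟨r, hr, hrx⟩ := Nat.exists_prime_and_dvd hx1
  exact h1 r hr fun y hy => ⟨_, Nat.eq_prime_pow_of_unique_prime_dvd hy.orderOf_pos.ne'
    fun {s} hs hsy => h3 y x hy hx s r hs hr hsy hrx⟩

theorem HasTwoPrimeOrders.exists_ne (h : HasTwoPrimeOrders G) (r : ℕ) :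
    ∃ w : G, (orderOf w).Prime ∧ orderOf w ≠ r := by
  obtain ⟨z, w, hz, hw, hne⟩ := h
  by_cases h' : orderOf z = r
  · exact ⟨w, hw, fun h => hne (h'.trans h.symm)⟩
  · exact ⟨z, hz, h'⟩

theorem isOfFinOrder_of_prime {x : G} (h : (orderOf x).Prime) : IsOfFinOrder x :=
  orderOf_pos_iff.1 h.pos

theorem mem_zpowers_mul_of_commute {x w : G} (h : Commute x w)
    (hc : (orderOf x).Coprime (orderOf w)) : x ∈ zpowers (x * w) := by
  obtain ⟨k, hk⟩ := exists_pow_eq_self_of_coprime hc.symm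
  refine ⟨(orderOf w * k : ℕ), ?_⟩
  simp only
  rw [zpow_natCast, pow_mul, h.mul_pow, pow_orderOf_eq_one, mul_one, hk]

theorem HasTwoPrimeOrders.mem_zpowers_of_dominating (h : HasTwoPrimeOrders G) {x : G} (hx1 : x ≠ 1) (hd : ∀ y, IsOfFinOrder y → Linked y x) {y : G}
    (hy : IsOfFinOrder y) : y ∈ zpowers x := by
  rcases hd y hy with h' | hxy
  · exact h'.mem_zpowers
  refine IsNonzeroPower.mem_zpowers ?_
  by_contra hyx
  obtain ⟨r, i, j, hr, hi, hj⟩ := exists_prime_pow_of_powers_linked hy hxy hyx hx1 fun z hz =>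
    hd z (((isNonzeroPower_iff_of_isOfFinOrder hy).2 hz).isOfFinOrder_iff.2 hy)
  obtain ⟨w, hw, hwr⟩ := h.exists_ne r
  have hc : (orderOf x).Coprime (orderOf w) := by
    rw [hi]
    exact Nat.Coprime.pow_left i ((Nat.coprime_primes hr hw).2 hwr.symm)
  rcases (hd w (isOfFinOrder_of_prime hw)).orderOf_dvd_or with h' | h'
  · exact hw.one_lt.ne' (Nat.Coprime.eq_one_of_dvd hc.symm h')
  · exact hx1 (orderOf_eq_one_iff.1 (Nat.Coprime.eq_one_of_dvd hc h'))

theorem ncard_torsion_of_mem_zpowers {x : G} (hx : IsOfFinOrder x)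
    (h : ∀ z, IsOfFinOrder z → z ∈ zpowers x) : {z : G | IsOfFinOrder z}.ncard = orderOf x := by
  rw [← Nat.card_zpowers, ← SetLike.coe_sort_coe, Nat.card_coe_set_eq]
  congr 1
  ext z
  exact ⟨h z, fun hz => ((isNonzeroPower_iff_of_isOfFinOrder hx).2 hz).isOfFinOrder_iff.2 hx⟩

variable [Group.IsNilpotent G]

theorem commute_of_orderOf_coprime {x w : G} (hc : (orderOf x).Coprime (orderOf w)) :
    Commute x w :=
  commute_of_coprime G x w _ _ hc (pow_orderOf_eq_one x) (pow_orderOf_eq_one w)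

theorem orderOf_mul_of_coprime {x w : G} (hc : (orderOf x).Coprime (orderOf w)) :
    orderOf (x * w) = orderOf x * orderOf w :=
  (commute_of_orderOf_coprime hc).orderOf_mul_eq_mul_orderOf_of_coprime hc

theorem isOfFinOrder_mul_of_coprime {x w : G} (hx : IsOfFinOrder x) (hw : IsOfFinOrder w)
    (hc : (orderOf x).Coprime (orderOf w)) : IsOfFinOrder (x * w) := by
  rw [← orderOf_pos_iff, orderOf_mul_of_coprime hc]
  exact Nat.mul_pos hx.orderOf_pos hw.orderOf_pos

theorem isNonzeroPower_mul_of_coprime {x w : G} (hx : IsOfFinOrder x) (hw : IsOfFinOrder w)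
    (hc : (orderOf x).Coprime (orderOf w)) : x ≼ x * w :=
  (isNonzeroPower_iff_of_isOfFinOrder (isOfFinOrder_mul_of_coprime hx hw hc)).2
    (mem_zpowers_mul_of_commute (commute_of_orderOf_coprime hc) hc)

/-- Twins generating different groups would have orders powers of one prime `r`. Multiplying the
smaller, `x`, by a commuting `w` of another prime order gives a root of `x` whose order rules out a
link with `y`. -/
theorem HasTwoPrimeOrders.zpowers_eq_of_twins (h : HasTwoPrimeOrders G) {x y : G}
    (hx : IsOfFinOrder x) (hx1 : x ≠ 1) (hy1 : y ≠ 1) (hxy : Twins x y) :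
    zpowers x = zpowers y := by
  wlog hle : x ≼ y generalizing x y
  · exact (this (hxy.linked.isOfFinOrder_iff.1 hx) hy1 hx1 hxy.symm
      (hxy.linked.resolve_left hle)).symm
  refine hle.zpowers_eq ?_
  by_contra hyx
  have hy := hle.isOfFinOrder_iff.1 hx
  obtain ⟨r, i, j, hr, hi, hj⟩ := exists_prime_pow_of_powers_linked hy hle hyx hx1 fun z hz =>
    (hxy z).2 (Or.inl ((isNonzeroPower_iff_of_isOfFinOrder hy).2 hz))
  obtain ⟨w, hw, hwr⟩ := h.exists_ne r
  have hc : (orderOf x).Coprime (orderOf w) := by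
    rw [hi]
    exact Nat.Coprime.pow_left i ((Nat.coprime_primes hr hw).2 hwr.symm)
  rcases (hxy (x * w)).1 (Or.inr (isNonzeroPower_mul_of_coprime hx (isOfFinOrder_of_prime hw) hc))
    with h' | h'
  · have := (dvd_mul_left _ _).trans ((orderOf_mul_of_coprime hc) ▸ h'.orderOf_dvd)
    rw [hj] at this
    exact hwr ((Nat.prime_dvd_prime_iff_eq hw hr).1 (hw.dvd_of_dvd_pow this))
  · have h2 := h'.orderOf_dvd
    rw [orderOf_mul_of_coprime hc] at h2
    have hc' : (orderOf y).Coprime (orderOf w) := by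
      rw [hj]
      exact Nat.Coprime.pow_left j ((Nat.coprime_primes hr hw).2 hwr.symm)
    exact hyx (hle.of_orderOf_dvd hx (hc'.dvd_of_dvd_mul_right h2))

end OneGroup

/-! ### Isomorphisms between torsion components with two prime orders -/

section TwoGroups

variable {G : Type*} {H : Type*} [Group G] [Group H] {f : G ≃ H}

theorem commensurable_one_iff {x : G} : Commensurable 1 x ↔ IsOfFinOrder x :=
  ⟨fun h => h.isOfFinOrder_iff.1 IsOfFinOrder.one,
    fun h => IsOfFinOrder.commensurable IsOfFinOrder.one h⟩

theorem componentIso_one_of_equiv (e : {x : G // IsOfFinOrder x} ≃ {y : H // IsOfFinOrder y})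
    (he : ∀ a b, (e a : H) ≼ e b ↔ (a : G) ≼ b) : ComponentIso (1 : G) (1 : H) :=
  ⟨((Equiv.subtypeEquivRight fun _ => commensurable_one_iff).trans e).trans
    (Equiv.subtypeEquivRight fun _ => commensurable_one_iff.symm), fun _ _ => he _ _⟩

theorem componentIso_one_of_cyclic {x : G} {y : H} (hx : IsOfFinOrder x) (hy : IsOfFinOrder y)
    (hG : ∀ z, IsOfFinOrder z → z ∈ zpowers x) (hH : ∀ z, IsOfFinOrder z → z ∈ zpowers y)
    (h : orderOf x = orderOf y) : ComponentIso (1 : G) (1 : H) := by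
  have hG' : ∀ z, IsOfFinOrder z ↔ z ∈ zpowers x := fun z =>
    ⟨hG z, fun hz => ((isNonzeroPower_iff_of_isOfFinOrder hx).2 hz).isOfFinOrder_iff.2 hx⟩
  have hH' : ∀ z, IsOfFinOrder z ↔ z ∈ zpowers y := fun z =>
    ⟨hH z, fun hz => ((isNonzeroPower_iff_of_isOfFinOrder hy).2 hz).isOfFinOrder_iff.2 hy⟩
  have e : zpowers x ≃* zpowers y :=
    mulEquivOfCyclicCardEq (by rw [Nat.card_zpowers, Nat.card_zpowers, h])
  refine componentIso_one_of_equiv ((Equiv.subtypeEquivRight hG').trans (e.toEquiv.trans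
    (Equiv.subtypeEquivRight fun z => (hH' z).symm))) fun a b => ?_
  obtain ⟨a, ha⟩ := a
  obtain ⟨b, hb⟩ := b
  constructor
  · rintro ⟨n, hn, h⟩
    refine ⟨n, hn, ?_⟩
    have h2 : e ⟨b, hG b hb⟩ ^ n = e ⟨a, hG a ha⟩ := Subtype.ext h
    rw [← map_zpow] at h2
    exact congrArg Subtype.val (e.injective h2)
  · rintro ⟨n, hn, h⟩
    refine ⟨n, hn, ?_⟩
    have h2 : e ⟨b, hG b hb⟩ ^ n = e ⟨a, hG a ha⟩ := by
      rw [← map_zpow]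
      exact congrArg e (Subtype.ext h)
    exact congrArg Subtype.val h2

theorem totient_eq_of_dvd {m n : ℕ} (hn : 0 < n) (h : m ∣ n) (hne : m ≠ n)
    (ht : m.totient = n.totient) : Odd m ∧ n = 2 * m := by
  obtain ⟨c, rfl⟩ := h
  have hm : 0 < m := Nat.pos_of_mul_pos_right hn
  have hc : 0 < c := Nat.pos_of_mul_pos_left hn
  have hmt := Nat.totient_pos.2 hm
  have h1 := Nat.totient_super_multiplicative m c
  rw [← ht] at h1
  have h2 : c.totient ≤ 1 := by nlinarith
  have h3 : c.totient = 1 := le_antisymm h2 (Nat.totient_pos.2 hc)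
  rcases Nat.totient_eq_one_iff.1 h3 with rfl | rfl
  · simp at hne
  refine ⟨?_, mul_comm m 2⟩
  by_contra ho
  rw [mul_comm, Nat.totient_two_mul_of_even (Nat.not_odd_iff_even.1 ho)] at ht
  omega

theorem ncard_torsion_eq (hf : PreservesLinked f) :
    {x : G | IsOfFinOrder x}.ncard = {y : H | IsOfFinOrder y}.ncard := by
  rw [← Set.ncard_image_of_injective _ f.injective]
  congr 1
  ext y
  obtain ⟨x, rfl⟩ := f.surjective y
  rw [f.injective.mem_set_image]
  exact (hf.isOfFinOrder_iff x).symm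

theorem linked_map_one (hf : PreservesLinked f) (y : H) (hy : IsOfFinOrder y) :
    Linked y (f 1) := by
  obtain ⟨x, rfl⟩ := f.surjective y
  rw [hf]
  exact Or.inr (IsOfFinOrder.one_isNonzeroPower ((hf.isOfFinOrder_iff x).1 hy))

variable [Group.IsNilpotent G] [Group.IsNilpotent H]

theorem totient_orderOf_map (hf : PreservesLinked f) (hG : HasTwoPrimeOrders G)
    (hH : HasTwoPrimeOrders H) (h1 : f 1 = 1) {x : G} (hx : IsOfFinOrder x) (hx1 : x ≠ 1) :
    (orderOf (f x)).totient = (orderOf x).totient := by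
  have hfx1 : f x ≠ 1 := fun h => hx1 (f.injective (h.trans h1.symm))
  have hfx : IsOfFinOrder (f x) := (hf.isOfFinOrder_iff x).2 hx
  rw [← ncard_generators hx, ← ncard_generators hfx, ← Set.ncard_image_of_injective _ f.injective]
  congr 1
  ext y
  obtain ⟨z, rfl⟩ := f.surjective y
  rw [f.injective.mem_set_image]
  constructor
  · intro (h : zpowers (f z) = zpowers (f x))
    have hz1 : z ≠ 1 := by
      rintro rfl
      rw [h1, zpowers_one_eq_bot, eq_comm, zpowers_eq_bot] at h
      exact hfx1 h
    have hz := isOfFinOrder_of_zpowers_eq h hfx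
    exact hG.zpowers_eq_of_twins ((hf.isOfFinOrder_iff z).1 hz) hz1 hx1
      (hf.twins_iff.1 (twins_of_zpowers_eq h hfx))
  · intro (h : zpowers z = zpowers x)
    have hz1 : z ≠ 1 := by
      rintro rfl
      rw [zpowers_one_eq_bot, eq_comm, zpowers_eq_bot] at h
      exact hx1 h
    have hz := isOfFinOrder_of_zpowers_eq h hx
    exact hH.zpowers_eq_of_twins ((hf.isOfFinOrder_iff z).2 hz)
      (fun h => hz1 (f.injective (h.trans h1.symm))) hfx1
      (hf.twins_iff.2 (twins_of_zpowers_eq h hx))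

/-- A strict reversal would make the totients of the orders of `x` and `y` divide each other, hence
agree, so the orders are `m` and `2 * m` with `m` odd. The involution in the group of `y` excludes
this. -/
theorem map_isNonzeroPower_of_hasTwoPrimeOrders (hf : PreservesLinked f)
    (hG : HasTwoPrimeOrders G) (hH : HasTwoPrimeOrders H) (h1 : f 1 = 1) {x y : G}
    (hy : IsOfFinOrder y) (hxy : x ≼ y) : f x ≼ f y := by
  have hx := hxy.isOfFinOrder_iff.2 hy
  have hfx := (hf.isOfFinOrder_iff x).2 hx
  have hfy := (hf.isOfFinOrder_iff y).2 hy
  by_cases hx1 : x = 1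
  · rw [hx1, h1]; exact IsOfFinOrder.one_isNonzeroPower hfy
  have hne : ∀ {z : G}, z ≠ 1 → f z ≠ 1 := fun hz h => hz (f.injective (h.trans h1.symm))
  have hy1 : y ≠ 1 := by
    rintro rfl
    exact hx1 (by simpa using hxy.mem_zpowers)
  by_cases hyx : y ≼ x
  · exact isNonzeroPower_of_zpowers_eq (hH.zpowers_eq_of_twins hfx (hne hx1) (hne hy1)
      (hf.twins_iff.2 (hxy.twins hyx))) hfy
  by_contra hnot
  have hrev := ((hf x y).2 (Or.inl hxy)).resolve_left hnot
  have ht : (orderOf x).totient = (orderOf y).totient := by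
    refine Nat.dvd_antisymm (Nat.totient_dvd_of_dvd hxy.orderOf_dvd) ?_
    rw [← totient_orderOf_map hf hG hH h1 hx hx1, ← totient_orderOf_map hf hG hH h1 hy hy1]
    exact Nat.totient_dvd_of_dvd hrev.orderOf_dvd
  obtain ⟨hodd, h2⟩ := totient_eq_of_dvd hy.orderOf_pos hxy.orderOf_dvd
    (fun h => hyx (hxy.of_orderOf_dvd hx h.symm.dvd)) ht
  obtain ⟨t, hty, ht2⟩ := exists_mem_zpowers_orderOf_eq hy (h2 ▸ dvd_mul_right 2 (orderOf x))
  have hty' : t ≼ y := (isNonzeroPower_iff_of_isOfFinOrder hy).2 hty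
  have ht0 := hty'.isOfFinOrder_iff.2 hy
  have ht1 : t ≠ 1 := by rintro rfl; simp at ht2
  have hxt : ¬ Linked x t := by
    intro h
    rcases h.orderOf_dvd_or with h | h
    · rw [ht2] at h
      rcases (Nat.dvd_prime Nat.prime_two).1 h with h | h
      · exact hx1 (orderOf_eq_one_iff.1 h)
      · rw [h] at hodd; exact absurd hodd (by decide)
    · rw [ht2] at h
      exact (Nat.not_even_iff_odd.2 hodd) (even_iff_two_dvd.2 h)
  -- Otherwise `f t ≼ f y ≼ f x` would link `t` with `x`, whose orders 2 and odd forbid it.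
  have hft : f y ≼ f t := by
    rcases (hf y t).2 (Or.inr hty') with h | h
    · exact h
    · rcases (hf x y).2 (Or.inl hxy) with h' | h'
      · exact absurd h' hnot
      · exact absurd ((hf _ _).1 (Or.inr (h.trans h'))) hxt
  have hfto : orderOf (f t) = 2 := by
    have := totient_orderOf_map hf hG hH h1 ht0 ht1
    rw [ht2, Nat.totient_two, Nat.totient_eq_one_iff, orderOf_eq_one_iff] at this
    exact this.resolve_left (hne ht1)
  have hdvd := hft.orderOf_dvd
  rw [hfto, Nat.dvd_prime Nat.prime_two, orderOf_eq_one_iff] at hdvd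
  have hback := hft.of_orderOf_dvd hfy
    (by rw [hfto, hdvd.resolve_left (hne hy1)])
  have htw := hG.zpowers_eq_of_twins ht0 ht1 hy1 (hf.twins_iff.1 (hback.twins hft))
  rw [zpowers_eq_iff_orderOf hy, ht2, h2] at htw
  have : orderOf x = 1 := by omega
  exact hx1 (orderOf_eq_one_iff.1 this)

theorem componentIso_one_of_hasTwoPrimeOrders (hf : PreservesLinked f)
    (hG : HasTwoPrimeOrders G) (hH : HasTwoPrimeOrders H) : ComponentIso (1 : G) (1 : H) := by
  by_cases h1 : f 1 = 1
  · refine componentIso_one_of_equiv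
      (f.subtypeEquiv fun x => (hf.isOfFinOrder_iff x).symm) fun a b => ⟨fun h => ?_, fun h => ?_⟩
    · have h1' : f.symm 1 = 1 := by rw [Equiv.symm_apply_eq, h1]
      have := map_isNonzeroPower_of_hasTwoPrimeOrders hf.symm hH hG h1'
        ((hf.isOfFinOrder_iff _).2 b.2) h
      simpa using this
    · exact map_isNonzeroPower_of_hasTwoPrimeOrders hf hG hH h1 b.2 h
  -- When `f` moves 1, each side has a dominating element other than 1, so both torsion parts are
  -- cyclic; they have equal size, and `f` can be discarded.
  · have h1' : f.symm 1 ≠ 1 := fun h => h1 (by rw [← h, f.apply_symm_apply])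
    have hx := (hf.symm.isOfFinOrder_iff 1).2 IsOfFinOrder.one
    have hy := (hf.isOfFinOrder_iff 1).2 IsOfFinOrder.one
    have hgen : ∀ z, IsOfFinOrder z → z ∈ zpowers (f.symm 1) := fun z hz =>
      hG.mem_zpowers_of_dominating h1' (linked_map_one hf.symm) hz
    have hgen' : ∀ z, IsOfFinOrder z → z ∈ zpowers (f 1) := fun z hz =>
      hH.mem_zpowers_of_dominating h1 (linked_map_one hf) hz
    refine componentIso_one_of_cyclic hx hy hgen hgen' ?_
    rw [← ncard_torsion_of_mem_zpowers hx hgen, ← ncard_torsion_of_mem_zpowers hy hgen',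
      ncard_torsion_eq hf]

end TwoGroups

/-! ### Primary torsion and neighbourhood inclusion -/

section Primary

variable {G : Type*} [Group G] {r : ℕ}

theorem TorsionIsPrimary.orderOf_dvd_or (hG : TorsionIsPrimary r G) {x y : G}
    (hx : IsOfFinOrder x) (hy : IsOfFinOrder y) : orderOf x ∣ orderOf y ∨ orderOf y ∣ orderOf x := by
  obtain ⟨i, hi⟩ := hG x hx
  obtain ⟨j, hj⟩ := hG y hy
  rw [hi, hj]
  exact (le_total i j).imp (pow_dvd_pow r) (pow_dvd_pow r)

theorem TorsionIsPrimary.linked (hG : TorsionIsPrimary r G) {x y z : G} (hz : IsOfFinOrder z)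
    (hx : x ≼ z) (hy : y ≼ z) : Linked x y := by
  have hx' := hx.isOfFinOrder_iff.2 hz
  have hy' := hy.isOfFinOrder_iff.2 hz
  exact (hG.orderOf_dvd_or hx' hy').imp
    (fun h => (isNonzeroPower_iff_of_isOfFinOrder hy').2
      (mem_zpowers_of_orderOf_dvd hx.mem_zpowers hy.mem_zpowers hz h))
    (fun h => (isNonzeroPower_iff_of_isOfFinOrder hx').2
      (mem_zpowers_of_orderOf_dvd hy.mem_zpowers hx.mem_zpowers hz h))

theorem TorsionIsPrimary.linked_of_isNonzeroPower (hG : TorsionIsPrimary r G) {x y z : G}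
    (hy : IsOfFinOrder y) (hxy : x ≼ y) (hz : Linked z y) : Linked z x :=
  hz.elim (fun h => hG.linked hy h hxy) (fun h => Or.inr (hxy.trans h))

theorem zpowers_mul_eq_of_isNonzeroPower (hr : r.Prime) (hG : TorsionIsPrimary r G) {u a : G}
    (ha : IsOfFinOrder a) (hua : u ≼ a) (hau : ¬ a ≼ u) : zpowers (u * a) = zpowers a := by
  have hu := hua.isOfFinOrder_iff.2 ha
  rw [zpowers_eq_iff_orderOf ha]
  have hmem : u * a ∈ zpowers a := mul_mem hua.mem_zpowers (mem_zpowers a)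
  refine ⟨hmem, ?_⟩
  obtain ⟨t, ht⟩ := hG a ha
  have hdvd := orderOf_dvd_of_mem_zpowers hmem
  obtain ⟨s, hs, hus⟩ := (Nat.dvd_prime_pow hr).1 (ht ▸ hua.orderOf_dvd)
  have hst : s ≠ t := by
    rintro rfl
    exact hau (hua.of_orderOf_dvd hu (by rw [ht, hus]))
  obtain ⟨k, rfl⟩ : ∃ k, t = k + 1 := ⟨t - 1, by omega⟩
  have hu1 : u ^ r ^ k = 1 :=
    orderOf_dvd_iff_pow_eq_one.1 (hus ▸ pow_dvd_pow r (by omega))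
  have hcomm : Commute u a := by
    obtain ⟨n, -, rfl⟩ := hua
    exact Commute.zpow_self a n
  rw [ht]
  have : Fact r.Prime := ⟨hr⟩
  refine orderOf_eq_prime_pow ?_ (orderOf_dvd_iff_pow_eq_one.1 (ht ▸ hdvd))
  rw [hcomm.mul_pow, hu1, one_mul, ← orderOf_dvd_iff_pow_eq_one, ht,
    Nat.pow_dvd_pow_iff_le_right hr.one_lt]
  omega

/-- The elements whose closed neighbourhood contains that of `x`. -/
def nbhdAbove (x : G) : Set G := {z | ∀ u, Linked u x → Linked u z}

theorem self_mem_nbhdAbove (x : G) : x ∈ nbhdAbove x := fun _ h => h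

theorem linked_of_mem_nbhdAbove {x z : G} (hz : z ∈ nbhdAbove x) : Linked z x :=
  (hz x (.refl x)).symm

theorem isOfFinOrder_of_mem_nbhdAbove {x z : G} (hx : IsOfFinOrder x) (hz : z ∈ nbhdAbove x) :
    IsOfFinOrder z := (linked_of_mem_nbhdAbove hz).isOfFinOrder_iff.2 hx

theorem linked_of_mem_nbhdAbove_of_mem {x y z : G} (hy : y ∈ nbhdAbove x)
    (hz : z ∈ nbhdAbove x) : Linked y z := hz y (linked_of_mem_nbhdAbove hy)

theorem TorsionIsPrimary.mem_nbhdAbove (hG : TorsionIsPrimary r G) {x y z : G}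
    (hx : IsOfFinOrder x) (hy : y ∈ nbhdAbove x) (hz : z ≼ y) : z ∈ nbhdAbove x :=
  fun u hu => hG.linked_of_isNonzeroPower (isOfFinOrder_of_mem_nbhdAbove hx hy) hz (hy u hu)

theorem twins_iff_mem_nbhdAbove {x z : G} : Twins z x ↔ z ∈ nbhdAbove x ∧ x ∈ nbhdAbove z :=
  ⟨fun h => ⟨fun u => (h u).2, fun u => (h u).1⟩, fun h u => ⟨h.2 u, h.1 u⟩⟩

/-- The set is a chain closed under taking powers, so when finite it is generated by a member of
largest order. -/
theorem TorsionIsPrimary.exists_nbhdAbove_eq_zpowers (hG : TorsionIsPrimary r G) {x : G}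
    (hx : IsOfFinOrder x) (hfin : (nbhdAbove x).Finite) :
    ∃ y : G, IsOfFinOrder y ∧ nbhdAbove x = (zpowers y : Set G) := by
  obtain ⟨y, hy, hmax⟩ := hfin.exists_maximalFor orderOf _ ⟨x, self_mem_nbhdAbove x⟩
  have hyf := isOfFinOrder_of_mem_nbhdAbove hx hy
  refine ⟨y, hyf, Set.Subset.antisymm (fun z hz => ?_) fun z hz => ?_⟩
  · have hzf := isOfFinOrder_of_mem_nbhdAbove hx hz
    rcases linked_of_mem_nbhdAbove_of_mem hz hy with h | h
    · exact h.mem_zpowers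
    · have h1 := hmax hz (Nat.le_of_dvd hzf.orderOf_pos h.orderOf_dvd)
      exact (h.of_orderOf_dvd hyf
        (le_antisymm (Nat.le_of_dvd hzf.orderOf_pos h.orderOf_dvd) h1).symm.dvd).mem_zpowers
  · exact hG.mem_nbhdAbove hx hy ((isNonzeroPower_iff_of_isOfFinOrder hyf).2 hz)

/-- The non-twins form a lower part of the chain `nbhdAbove x`. A twin's cyclic group strictly
contains all of them, while a non-twin's consists of non-twins only. -/
theorem TorsionIsPrimary.twins_iff_lt_orderOf (hG : TorsionIsPrimary r G) {x z : G}
    (hx : IsOfFinOrder x) (hfin : (nbhdAbove x).Finite) (hz : z ∈ nbhdAbove x) :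
    Twins z x ↔ (nbhdAbove x \ {u | Twins u x}).ncard < orderOf z := by
  have hzf := isOfFinOrder_of_mem_nbhdAbove hx hz
  have hdown : ∀ {a b : G}, a ≼ b → b ∈ nbhdAbove x → ¬ Twins b x → ¬ Twins a x :=
    fun {a b} hab hb hbt hat => hbt (twins_iff_mem_nbhdAbove.2 ⟨hb, fun u hu => (hat u).1
      (hG.linked_of_isNonzeroPower (isOfFinOrder_of_mem_nbhdAbove hx hb) hab hu)⟩)
  have hcard : (zpowers z : Set G).ncard = orderOf z := by
    rw [← Nat.card_coe_set_eq, SetLike.coe_sort_coe, Nat.card_zpowers]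
  constructor
  · intro h
    rw [← hcard]
    refine Set.ncard_lt_ncard ⟨?_, ?_⟩ hzf.finite_zpowers
    · rintro u ⟨hu, hut⟩
      rcases linked_of_mem_nbhdAbove_of_mem hu hz with h' | h'
      · exact h'.mem_zpowers
      · exact absurd h (hdown h' hu hut)
    · exact fun hsub => (hsub (mem_zpowers z)).2 h
  · intro h
    by_contra hzt
    suffices hsub : (zpowers z : Set G) ⊆ nbhdAbove x \ {u | Twins u x} by
      have := Set.ncard_le_ncard hsub hfin.sdiff
      omega
    intro u hu
    have hu' := (isNonzeroPower_iff_of_isOfFinOrder hzf).2 hu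
    exact ⟨hG.mem_nbhdAbove hx hz hu', hdown hu' hz hzt⟩

/-- The right side depends only on cardinalities visible in the undirected graph, so an isomorphism
preserves the count for each order. -/
theorem TorsionIsPrimary.ncard_twins_orderOf_eq (hG : TorsionIsPrimary r G) {x : G}
    (hx : IsOfFinOrder x) (hfin : (nbhdAbove x).Finite) (n : ℕ) :
    {z | Twins z x ∧ orderOf z = n}.ncard =
      if n ∣ (nbhdAbove x).ncard ∧ (nbhdAbove x \ {u | Twins u x}).ncard < n
        then n.totient else 0 := by
  obtain ⟨y, hy, hxy⟩ := hG.exists_nbhdAbove_eq_zpowers hx hfin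
  have hcard : (nbhdAbove x).ncard = orderOf y := by
    rw [hxy, ← Nat.card_coe_set_eq, SetLike.coe_sort_coe, Nat.card_zpowers]
  rw [hcard]
  split_ifs with h
  · rw [← ncard_orderOf_eq_in_zpowers hy h.1]
    congr 1
    ext z
    have hmem : z ∈ zpowers y ↔ z ∈ nbhdAbove x := by rw [hxy]; rfl
    constructor
    · rintro ⟨h1, h2⟩
      exact ⟨hmem.2 (twins_iff_mem_nbhdAbove.1 h1).1, h2⟩
    · rintro ⟨h1, rfl⟩
      exact ⟨(hG.twins_iff_lt_orderOf hx hfin (hmem.1 h1)).2 h.2, rfl⟩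
  · convert Set.ncard_empty G
    rw [Set.eq_empty_iff_forall_notMem]
    rintro z ⟨h1, rfl⟩
    have hz := (twins_iff_mem_nbhdAbove.1 h1).1
    refine h ⟨?_, (hG.twins_iff_lt_orderOf hx hfin hz).1 h1⟩
    rw [hxy] at hz
    exact orderOf_dvd_of_mem_zpowers hz

/-- Neighbourhoods shrink on going up, so the graph fixes the direction except between twins, where
the orders decide. -/
theorem TorsionIsPrimary.isNonzeroPower_iff (hG : TorsionIsPrimary r G) {x y : G}
    (hx : IsOfFinOrder x) (hy : IsOfFinOrder y) : x ≼ y ↔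
      Linked x y ∧ (∀ z, Linked z y → Linked z x) ∧ (Twins x y → orderOf x ∣ orderOf y) := by
  constructor
  · exact fun h => ⟨Or.inl h, fun z => hG.linked_of_isNonzeroPower hy h, fun _ => h.orderOf_dvd⟩
  · rintro ⟨h | h, h1, h2⟩
    · exact h
    · refine h.of_orderOf_dvd hy (h2 fun z => ⟨hG.linked_of_isNonzeroPower hx h, h1 z⟩)

/-- The torsion elements are infinitely many and pairwise linked. -/
def InfiniteTorsionChain (G : Type*) [Group G] : Prop :=
  {x : G | IsOfFinOrder x}.Infinite ∧
    ∀ x y : G, IsOfFinOrder x → IsOfFinOrder y → Linked x y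

theorem exists_not_mem_zpowers_of_infinite {S : Set G} (hS : S.Infinite) {x : G}
    (hx : IsOfFinOrder x) : ∃ y ∈ S, y ∉ zpowers x := by
  by_contra! h
  exact hS (hx.finite_zpowers.subset h)

/-- The infinite chain `P` is an `r`-divisible group, so it commutes with all torsion. Induction on
the order then puts every torsion element into `P`. -/
theorem TorsionIsPrimary.infiniteTorsionChain [Group.IsNilpotent G] (hr : r.Prime)
    (hG : TorsionIsPrimary r G) {x : G} (hx : IsOfFinOrder x) (hinf : (nbhdAbove x).Infinite) :
    InfiniteTorsionChain G := by
  set P := nbhdAbove x with hP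
  have hfin : ∀ {z}, z ∈ P → IsOfFinOrder z := fun hz => isOfFinOrder_of_mem_nbhdAbove hx hz
  have hlink : ∀ {y z}, y ∈ P → z ∈ P → Linked y z := linked_of_mem_nbhdAbove_of_mem
  have hdown : ∀ {y z}, y ∈ P → z ≼ y → z ∈ P := fun hy hz => hG.mem_nbhdAbove hx hy hz
  have hzp : ∀ {y z : G}, y ∈ P → z ∈ zpowers y → z ∈ P := fun hy hz =>
    hdown hy ((isNonzeroPower_iff_of_isOfFinOrder (hfin hy)).2 hz)
  have hmul : ∀ {y z}, y ∈ P → z ∈ P → y * z ∈ P := by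
    intro y z hy hz
    rcases hlink hy hz with h | h
    · exact hzp hz (mul_mem h.mem_zpowers (mem_zpowers z))
    · exact hzp hy (mul_mem (mem_zpowers y) h.mem_zpowers)
  have hinv : ∀ {y}, y ∈ P → y⁻¹ ∈ P := fun hy => hdown hy (inv_isNonzeroPower _)
  -- The infinite `P` does not fit into the finite group of `y`, so some member of `P` has `y` below
  -- it.
  have hbig : ∀ {y}, IsOfFinOrder y → (∀ z ∈ P, Linked y z) → y ∈ P := by
    intro y hy hyl
    obtain ⟨z, hz, hzy⟩ := exists_not_mem_zpowers_of_infinite hinf hy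
    exact hdown hz ((hyl z hz).resolve_right fun h => hzy h.mem_zpowers)
  have hroot : ∀ y ∈ P, ∃ z ∈ P, z ^ r = y := by
    intro y hy
    obtain ⟨z, hz, hzy⟩ := exists_not_mem_zpowers_of_infinite hinf (hfin hy)
    have hyz := (hlink hz hy).resolve_left fun h => hzy h.mem_zpowers
    obtain ⟨k, hk, rfl⟩ := hyz
    by_cases hrk : (r : ℤ) ∣ k
    · obtain ⟨c, rfl⟩ := hrk
      exact ⟨z ^ c, hzp hz (zpow_mem_zpowers z c), by rw [← zpow_natCast, ← zpow_mul, mul_comm]⟩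
    · exfalso
      apply hzy
      obtain ⟨t, ht⟩ := hG z (hfin hz)
      have hc : IsCoprime k (r ^ t : ℤ) := by
        refine IsCoprime.pow_right ?_
        exact ((Nat.prime_iff_prime_int.1 hr).coprime_iff_not_dvd.2 hrk).symm
      obtain ⟨a, b, hab⟩ := hc
      refine ⟨a, ?_⟩
      have hz1 : z ^ ((r : ℤ) ^ t) = 1 := by
        rw [← Nat.cast_pow, ← ht, zpow_natCast, pow_orderOf_eq_one]
      simp only
      rw [← zpow_mul]
      calc z ^ (k * a) = z ^ (a * k + b * (r : ℤ) ^ t) := by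
            rw [zpow_add, mul_comm b, zpow_mul z _ b, hz1, one_zpow, mul_one, mul_comm]
        _ = z := by rw [hab, zpow_one]
  have hcomm : ∀ y ∈ P, ∀ g : G, IsOfFinOrder g → Commute y g := by
    intro y hy g hg
    obtain ⟨k, hk⟩ := hG g hg
    exact commute_of_divisible G r P hroot g k (by rw [← hk, pow_orderOf_eq_one]) y hy
  have hall : ∀ k : ℕ, ∀ v : G, orderOf v = r ^ k → v ∈ P := by
    intro k
    induction k with
    | zero =>
      intro v hv
      rw [pow_zero, orderOf_eq_one_iff] at hv
      rw [hv]
      exact hdown (self_mem_nbhdAbove x) (IsOfFinOrder.one_isNonzeroPower hx)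
    | succ k ih =>
      intro v hv
      have hvf : IsOfFinOrder v := orderOf_pos_iff.1 (hv ▸ pow_pos hr.pos _)
      have hvr : v ^ r ∈ P := ih _ (by
        rw [orderOf_pow_of_dvd hr.ne_zero (hv ▸ dvd_pow_self r (Nat.succ_ne_zero k)), hv,
          pow_succ, Nat.mul_div_cancel _ hr.pos])
      obtain ⟨c, hc, hcv⟩ := hroot _ hvr
      obtain ⟨y, hy, hyx⟩ := hroot x (self_mem_nbhdAbove x)
      -- The quotient `v * c⁻¹` is killed by `r`. Multiplied by an `r`-th root `y` of `x`, it
      -- becomes another `r`-th root of `x`, hence is linked to all of `P`.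
      have h1 : (v * c⁻¹) ^ r = 1 := by
        rw [(hcomm c hc v hvf).symm.inv_right.mul_pow, inv_pow, hcv, mul_inv_cancel]
      have hvc : IsOfFinOrder (v * c⁻¹) := isOfFinOrder_iff_pow_eq_one.2 ⟨r, hr.pos, h1⟩
      have hyv := hcomm y hy _ hvc
      have h2 : (y * (v * c⁻¹)) ^ r = x := by rw [hyv.mul_pow, h1, mul_one, hyx]
      have h3 : x ≼ y * (v * c⁻¹) := ⟨r, by exact_mod_cast hr.ne_zero, by rw [zpow_natCast, h2]⟩
      have h4 : y * (v * c⁻¹) ∈ P := hbig (h3.isOfFinOrder_iff.1 hx) fun z hz => hz _ (Or.inr h3)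
      have h5 := hmul (hmul (hinv hy) h4) hc
      simpa [mul_assoc] using h5
  have hall' : ∀ v, IsOfFinOrder v → v ∈ P := fun v hv => by
    obtain ⟨k, hk⟩ := hG v hv
    exact hall k v hk
  exact ⟨hinf.mono fun z hz => hfin hz, fun y z hy hz => hlink (hall' y hy) (hall' z hz)⟩

end Primary

/-! ### Bijections assembled from fibres -/

section Fibers

theorem exists_equiv_of_fibers {A B K : Type*} (a : A → K) (b : B → K)
    (h : ∀ k, Nonempty ({x // a x = k} ≃ {y // b y = k})) :
    ∃ e : A ≃ B, ∀ x, b (e x) = a x := by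
  have e := fun k => (h k).some
  refine ⟨(Equiv.sigmaFiberEquiv a).symm.trans
    ((Equiv.sigmaCongrRight e).trans (Equiv.sigmaFiberEquiv b)), fun x => ?_⟩
  exact (e (a x) ⟨x, rfl⟩).2

end Fibers

/-! ### Comparing two torsion components with primary torsion on one side -/

section TwoGroups

variable {G : Type*} {H : Type*} [Group G] [Group H] {f : G ≃ H}

theorem InfiniteTorsionChain.map (hf : PreservesLinked f) (h : InfiniteTorsionChain G) :
    InfiniteTorsionChain H := by
  constructor
  · have := h.1.image f.injective.injOn
    refine this.mono ?_
    rintro _ ⟨x, hx, rfl⟩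
    exact (hf.isOfFinOrder_iff x).2 hx
  · intro x y hx hy
    obtain ⟨x, rfl⟩ := f.surjective x
    obtain ⟨y, rfl⟩ := f.surjective y
    exact (hf x y).2 (h.2 x y ((hf.isOfFinOrder_iff x).1 hx) ((hf.isOfFinOrder_iff y).1 hy))

theorem PreservesLinked.image_nbhdAbove (hf : PreservesLinked f) (x : G) :
    nbhdAbove (f x) = f '' nbhdAbove x := by
  ext y
  obtain ⟨z, rfl⟩ := f.surjective y
  rw [f.injective.mem_set_image]
  constructor
  · intro h u hu
    rw [← hf]
    exact h _ ((hf _ _).2 hu)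
  · intro h u hu
    obtain ⟨u, rfl⟩ := f.surjective u
    rw [hf] at hu ⊢
    exact h _ hu

theorem PreservesLinked.image_twins (hf : PreservesLinked f) (x : G) :
    {y | Twins y (f x)} = f '' {y | Twins y x} := by
  ext y
  obtain ⟨z, rfl⟩ := f.surjective y
  rw [f.injective.mem_set_image]
  exact hf.twins_iff

/-- The bijection matches pairs of twin class and order, with twin classes of `H` pulled back along
`f`. It differs from `f` only inside twin classes. -/
theorem componentIso_one_of_primary (hf : PreservesLinked f) {r s : ℕ}
    (hG : TorsionIsPrimary r G) (hH : TorsionIsPrimary s H)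
    (hfin : ∀ x : G, IsOfFinOrder x → (nbhdAbove x).Finite) : ComponentIso (1 : G) (1 : H) := by
  obtain ⟨e, he⟩ := exists_equiv_of_fibers
    (fun x : {x : G // IsOfFinOrder x} => (({z | Twins z (x : G)}, orderOf (x : G)) : Set G × ℕ))
    (fun y : {y : H // IsOfFinOrder y} => (f ⁻¹' {z | Twins z (y : H)}, orderOf (y : H))) (by
    rintro ⟨S, n⟩
    by_cases hS : ∃ x : G, IsOfFinOrder x ∧ S = {z | Twins z x}
    · obtain ⟨x, hx, rfl⟩ := hS
      have hxf := hfin x hx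
      have hsub : {z | Twins z x ∧ orderOf z = n}.Finite :=
        hxf.subset fun z hz => (twins_iff_mem_nbhdAbove.1 hz.1).1
      have hfx := (hf.isOfFinOrder_iff x).2 hx
      have hxf' : (nbhdAbove (f x)).Finite := by rw [hf.image_nbhdAbove]; exact hxf.image f
      have hsub' : {z | Twins z (f x) ∧ orderOf z = n}.Finite :=
        hxf'.subset fun z hz => (twins_iff_mem_nbhdAbove.1 hz.1).1
      have hcard : {z | Twins z x ∧ orderOf z = n}.ncard =
          {z | Twins z (f x) ∧ orderOf z = n}.ncard := by
        rw [hG.ncard_twins_orderOf_eq hx hxf, hH.ncard_twins_orderOf_eq hfx hxf',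
          hf.image_nbhdAbove, hf.image_twins, ← Set.image_sdiff f.injective,
          Set.ncard_image_of_injective _ f.injective, Set.ncard_image_of_injective _ f.injective]
      have := hsub.to_subtype
      have := hsub'.to_subtype
      have e₀ : {z | Twins z x ∧ orderOf z = n} ≃ {z | Twins z (f x) ∧ orderOf z = n} :=
        (Finite.card_eq.1 (by rw [Nat.card_coe_set_eq, Nat.card_coe_set_eq, hcard])).some
      have hset : ∀ z, ({u | Twins u z} = {u | Twins u x} ∧ orderOf z = n) ↔
          (Twins z x ∧ orderOf z = n) := fun z => and_congr_left fun _ =>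
        ⟨fun h => h.subset (fun _ => Iff.rfl : Twins z z),
          fun h => Set.ext fun u => ⟨fun k => k.trans h, fun k => k.trans h.symm⟩⟩
      have hset' : ∀ z, (f ⁻¹' {u | Twins u z} = {u | Twins u x} ∧ orderOf z = n) ↔
          (Twins z (f x) ∧ orderOf z = n) := fun z => and_congr_left fun _ => by
        rw [Set.preimage_eq_iff_eq_image f.bijective, ← hf.image_twins]
        exact ⟨fun h => h.subset (fun _ => Iff.rfl : Twins z z),
          fun h => Set.ext fun u => ⟨fun k => k.trans h, fun k => k.trans h.symm⟩⟩
      refine ⟨Equiv.trans ?_ (e₀.trans (Equiv.symm ?_))⟩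
      · refine ⟨fun z => ⟨z.1, (hset _).1 (Prod.ext_iff.1 z.2)⟩,
          fun z => ⟨⟨z, z.2.1.linked.isOfFinOrder_iff.2 hx⟩, Prod.ext_iff.2 ((hset _).2 z.2)⟩,
          fun z => rfl, fun z => rfl⟩
      · refine ⟨fun z => ⟨z.1, (hset' _).1 (Prod.ext_iff.1 z.2)⟩,
          fun z => ⟨⟨z, z.2.1.linked.isOfFinOrder_iff.2 hfx⟩, Prod.ext_iff.2 ((hset' _).2 z.2)⟩,
          fun z => rfl, fun z => rfl⟩
    · have h1 : IsEmpty {x : {x : G // IsOfFinOrder x} //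
          ((({z | Twins z (x : G)}, orderOf (x : G)) : Set G × ℕ)) = (S, n)} :=
        ⟨fun x => hS ⟨x.1, x.1.2, (Prod.ext_iff.1 x.2).1.symm⟩⟩
      have h2 : IsEmpty {y : {y : H // IsOfFinOrder y} //
          (f ⁻¹' {z | Twins z (y : H)}, orderOf (y : H)) = (S, n)} := by
        refine ⟨fun y => ?_⟩
        obtain ⟨⟨y, hy⟩, hyS⟩ := y
        obtain ⟨x, rfl⟩ := f.surjective y
        refine hS ⟨x, (hf.isOfFinOrder_iff x).1 hy, ?_⟩
        have h3 : f ⁻¹' {z | Twins z (f x)} = S := (Prod.ext_iff.1 hyS).1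
        rw [← h3, hf.image_twins, Set.preimage_image_eq _ f.injective]
      exact ⟨Equiv.equivOfIsEmpty _ _⟩)
  have htw : ∀ x, Twins (e x : H) (f x) := fun x => by
    have h1 : f ⁻¹' {z | Twins z (e x : H)} = {z | Twins z (x : G)} := (Prod.ext_iff.1 (he x)).1
    rw [Set.preimage_eq_iff_eq_image f.bijective, ← hf.image_twins] at h1
    exact h1.subset (fun _ => Iff.rfl : Twins (e x : H) (e x))
  have hord : ∀ x, orderOf (e x : H) = orderOf (x : G) := fun x => (Prod.ext_iff.1 (he x)).2
  refine componentIso_one_of_equiv e fun a b => ?_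
  rw [hG.isNonzeroPower_iff a.2 b.2, hH.isNonzeroPower_iff (e a).2 (e b).2,
    (htw a).linked_congr (htw b), hf, hord, hord]
  refine and_congr_right fun _ => and_congr ?_ ?_
  · rw [← f.forall_congr_right]
    refine forall_congr' fun z => ?_
    rw [htw a (f z), htw b (f z), hf, hf]
  · refine imp_congr_left ?_
    rw [← hf.twins_iff]
    exact ⟨fun h => (htw a).symm.trans (h.trans (htw b)), fun h => (htw a).trans (h.trans (htw b).symm)⟩

/-- A generator `v` of the group of `z * w` is linked to the unlinked `z` and `w`, so in the primary
group its preimage lies strictly below that of `z`. Multiplying by the latter gives again a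
generator of its group; this injects the generators for `z * w` into those for `z`. -/
theorem totient_mul_le_of_primary [Group.IsNilpotent H] (hf : PreservesLinked f) {r : ℕ}
    (hr : r.Prime) (hG : TorsionIsPrimary r G) (hH : HasTwoPrimeOrders H) {z w : H}
    (hz : (orderOf z).Prime) (hw : (orderOf w).Prime) (hzw : orderOf z ≠ orderOf w) :
    (orderOf z * orderOf w).totient ≤ (orderOf z).totient := by
  have hc := (Nat.coprime_primes hz hw).2 hzw
  have hzf := isOfFinOrder_of_prime hz
  have hwf := isOfFinOrder_of_prime hw
  have hzwf := isOfFinOrder_mul_of_coprime hzf hwf hc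
  have hz1 : z ≼ z * w := isNonzeroPower_mul_of_coprime hzf hwf hc
  have hw1 : w ≼ z * w := by
    rw [(commute_of_orderOf_coprime hc).eq]
    exact isNonzeroPower_mul_of_coprime hwf hzf hc.symm
  have hnl : ¬ Linked z w := fun h => by
    rcases h.orderOf_dvd_or with h | h
    · exact hzw ((Nat.prime_dvd_prime_iff_eq hz hw).1 h)
    · exact hzw ((Nat.prime_dvd_prime_iff_eq hw hz).1 h).symm
  obtain ⟨a, rfl⟩ := f.surjective z
  obtain ⟨b, rfl⟩ := f.surjective w
  have haf := (hf.isOfFinOrder_iff a).1 hzf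
  rw [hf] at hnl
  rw [← orderOf_mul_of_coprime hc, ← ncard_generators hzwf, ← ncard_generators hzf]
  have hbelow : ∀ v, zpowers v = zpowers (f a * f b) → f.symm v ≼ a ∧ ¬ a ≼ f.symm v := by
    intro v hv
    have hvt := twins_of_zpowers_eq hv hzwf
    obtain ⟨u, rfl⟩ := f.surjective v
    rw [f.symm_apply_apply]
    have hua : Linked u a := by rw [linked_comm, ← hf, hvt]; exact Or.inl hz1
    have hub : Linked u b := by rw [linked_comm, ← hf, hvt]; exact Or.inl hw1
    have huf := hua.isOfFinOrder_iff.2 haf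
    have hnot : ¬ a ≼ u := fun h => hub.elim (fun h' => hnl (Or.inl (h.trans h')))
      (fun h' => hnl (hG.linked huf h h'))
    exact ⟨hua.resolve_right hnot, hnot⟩
  refine Set.ncard_le_ncard_of_injOn (fun v => f (f.symm v * a)) ?_ ?_ (finite_generators hzf)
  · intro v hv
    obtain ⟨h1, h2⟩ := hbelow v hv
    have h3 := zpowers_mul_eq_of_isNonzeroPower hr hG haf h1 h2
    have h4 := hf.twins_iff.2 (twins_of_zpowers_eq h3 haf)
    refine hH.zpowers_eq_of_twins (h4.linked.isOfFinOrder_iff.2 hzf) ?_ ?_ h4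
    · intro h5
      rw [h5] at h4
      exact hnl ((hf _ _).1 ((h4 (f b)).1 (Or.inr (IsOfFinOrder.one_isNonzeroPower hwf))).symm)
    · intro h5
      rw [h5, orderOf_one] at hz
      exact Nat.not_prime_one hz
  · intro v _ v' _ h
    exact f.symm.injective (mul_right_cancel (f.injective h))

theorem false_of_primary_of_hasTwoPrimeOrders [Group.IsNilpotent H] (hf : PreservesLinked f)
    {r : ℕ} (hr : r.Prime) (hG : TorsionIsPrimary r G) (hH : HasTwoPrimeOrders H) : False := by
  obtain ⟨z, w, hz, hw, hne⟩ := hH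
  have hH : HasTwoPrimeOrders H := ⟨z, w, hz, hw, hne⟩
  have h1 := totient_mul_le_of_primary hf hr hG hH hz hw hne
  have h2 := totient_mul_le_of_primary hf hr hG hH hw hz hne.symm
  rw [Nat.totient_mul ((Nat.coprime_primes hz hw).2 hne)] at h1
  rw [Nat.totient_mul ((Nat.coprime_primes hw hz).2 hne.symm)] at h2
  rw [Nat.totient_prime hz, Nat.totient_prime hw] at h1 h2
  have h3 := hz.two_le
  have h4 := hw.two_le
  obtain ⟨a, ha⟩ : ∃ a, orderOf z = a + 2 := ⟨orderOf z - 2, by omega⟩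
  obtain ⟨b, hb⟩ : ∃ b, orderOf w = b + 2 := ⟨orderOf w - 2, by omega⟩
  rw [ha, hb] at h1 h2 hne
  simp only [show a + 2 - 1 = a + 1 by omega,
    show b + 2 - 1 = b + 1 by omega] at h1 h2
  have h5 : b = 0 := by nlinarith
  have h6 : a = 0 := by nlinarith
  omega

theorem componentIso_one_or_infiniteTorsionChain [Group.IsNilpotent G] [Group.IsNilpotent H]
    (hf : PreservesLinked f) :
    ComponentIso (1 : G) (1 : H) ∨ (InfiniteTorsionChain G ∧ InfiniteTorsionChain H) := by
  rcases primary_or_hasTwoPrimeOrders G with ⟨r, hr, hG⟩ | hG <;>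
  rcases primary_or_hasTwoPrimeOrders H with ⟨s, hs, hH⟩ | hH
  · by_cases hfin : ∀ x : G, IsOfFinOrder x → (nbhdAbove x).Finite
    · exact Or.inl (componentIso_one_of_primary hf hG hH hfin)
    · push Not at hfin
      obtain ⟨x, hx, hinf⟩ := hfin
      have := hG.infiniteTorsionChain hr hx hinf
      exact Or.inr ⟨this, this.map hf⟩
  · exact (false_of_primary_of_hasTwoPrimeOrders hf hr hG hH).elim
  · exact (false_of_primary_of_hasTwoPrimeOrders hf.symm hs hH hG).elim
  · exact Or.inl (componentIso_one_of_hasTwoPrimeOrders hf hG hH)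

end TwoGroups

/-! ### Groups whose torsion is an infinite chain -/

section Chain

variable {G : Type*} [Group G] {p : ℕ}

theorem InfiniteTorsionChain.exists_primary (h : InfiniteTorsionChain G) :
    ∃ p, p.Prime ∧ TorsionIsPrimary p G := by
  refine (primary_or_hasTwoPrimeOrders G).resolve_right ?_
  rintro ⟨z, w, hz, hw, hne⟩
  rcases (h.2 z w (isOfFinOrder_of_prime hz) (isOfFinOrder_of_prime hw)).orderOf_dvd_or with h | h
  · exact hne ((Nat.prime_dvd_prime_iff_eq hz hw).1 h)
  · exact hne ((Nat.prime_dvd_prime_iff_eq hw hz).1 h).symm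

theorem InfiniteTorsionChain.exists_orderOf_eq (h : InfiniteTorsionChain G) (hp : p.Prime)
    (hG : TorsionIsPrimary p G) (k : ℕ) : ∃ x : G, orderOf x = p ^ k := by
  induction k with
  | zero => exact ⟨1, by simp⟩
  | succ k ih =>
    obtain ⟨x, hx⟩ := ih
    have hxf : IsOfFinOrder x := orderOf_pos_iff.1 (hx ▸ pow_pos hp.pos k)
    obtain ⟨y, hy, hyx⟩ := exists_not_mem_zpowers_of_infinite h.1 hxf
    have hxy := (h.2 y x hy hxf).resolve_left fun h => hyx h.mem_zpowers
    obtain ⟨j, hj⟩ := hG y hy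
    have hkj : k < j := by
      by_contra! hjk
      exact hyx (hxy.of_orderOf_dvd hxf (by rw [hj, hx]; exact pow_dvd_pow p hjk)).mem_zpowers
    obtain ⟨z, -, hz⟩ := exists_mem_zpowers_orderOf_eq hy
      (d := p ^ (k + 1)) (by rw [hj]; exact pow_dvd_pow p hkj)
    exact ⟨z, hz⟩

theorem InfiniteTorsionChain.isNonzeroPower_iff (h : InfiniteTorsionChain G) {x y : G}
    (hx : IsOfFinOrder x) (hy : IsOfFinOrder y) : x ≼ y ↔ orderOf x ∣ orderOf y :=
  ⟨fun h => h.orderOf_dvd, (h.2 x y hx hy).isNonzeroPower_of_orderOf_dvd hx⟩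

theorem InfiniteTorsionChain.setOf_orderOf_eq (h : InfiniteTorsionChain G) {y : G}
    (hy : IsOfFinOrder y) : {z | orderOf z = orderOf y} = {z | zpowers z = zpowers y} := by
  ext z
  refine ⟨fun hz => (zpowers_eq_iff_orderOf hy).2 ⟨?_, hz⟩, fun hz =>
    ((zpowers_eq_iff_orderOf hy).1 hz).2⟩
  have hz' : orderOf z = orderOf y := hz
  have hzf : IsOfFinOrder z := orderOf_pos_iff.1 (hz' ▸ hy.orderOf_pos)
  exact ((h.isNonzeroPower_iff hzf hy).2 hz'.dvd).mem_zpowers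

theorem componentIso_one_of_infiniteTorsionChain {H : Type*} [Group H] (hp : p.Prime)
    (hcG : InfiniteTorsionChain G) (hcH : InfiniteTorsionChain H) (hG : TorsionIsPrimary p G)
    (hH : TorsionIsPrimary p H) : ComponentIso (1 : G) (1 : H) := by
  obtain ⟨e, he⟩ := exists_equiv_of_fibers (fun x : {x : G // IsOfFinOrder x} => orderOf (x : G))
    (fun y : {y : H // IsOfFinOrder y} => orderOf (y : H)) (by
    intro n
    by_cases hn : ∃ k, n = p ^ k
    · obtain ⟨k, rfl⟩ := hn
      obtain ⟨x, hx⟩ := hcG.exists_orderOf_eq hp hG k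
      obtain ⟨y, hy⟩ := hcH.exists_orderOf_eq hp hH k
      have hxf : IsOfFinOrder x := orderOf_pos_iff.1 (hx ▸ pow_pos hp.pos k)
      have hyf : IsOfFinOrder y := orderOf_pos_iff.1 (hy ▸ pow_pos hp.pos k)
      have hG1 := ncard_generators hxf
      have hH1 := ncard_generators hyf
      have := (finite_generators hxf).to_subtype
      have := (finite_generators hyf).to_subtype
      rw [← hcG.setOf_orderOf_eq hxf] at *
      rw [← hcH.setOf_orderOf_eq hyf] at *
      have e₀ : {z | orderOf z = orderOf x} ≃ {z | orderOf z = orderOf y} := (Finite.card_eq.1 (by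
        rw [Nat.card_coe_set_eq, Nat.card_coe_set_eq, hG1, hH1, hx, hy])).some
      refine ⟨Equiv.trans ?_ (e₀.trans (Equiv.symm ?_))⟩
      · exact ⟨fun z => ⟨z.1, z.2.trans hx.symm⟩, fun z => ⟨⟨z, orderOf_pos_iff.1
          (by rw [show orderOf (z : G) = orderOf x from z.2]; exact hxf.orderOf_pos)⟩,
          z.2.trans hx⟩, fun z => rfl, fun z => rfl⟩
      · exact ⟨fun z => ⟨z.1, z.2.trans hy.symm⟩, fun z => ⟨⟨z, orderOf_pos_iff.1
          (by rw [show orderOf (z : H) = orderOf y from z.2]; exact hyf.orderOf_pos)⟩,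
          z.2.trans hy⟩, fun z => rfl, fun z => rfl⟩
    · have h1 : IsEmpty {x : {x : G // IsOfFinOrder x} // orderOf (x : G) = n} :=
        ⟨fun x => hn ((hG x x.1.2).imp fun k hk => x.2.symm.trans hk)⟩
      have h2 : IsEmpty {y : {y : H // IsOfFinOrder y} // orderOf (y : H) = n} :=
        ⟨fun y => hn ((hH y y.1.2).imp fun k hk => y.2.symm.trans hk)⟩
      exact ⟨Equiv.equivOfIsEmpty _ _⟩)
  refine componentIso_one_of_equiv e fun a b => ?_
  rw [hcG.isNonzeroPower_iff a.2 b.2, hcH.isNonzeroPower_iff (e a).2 (e b).2, he, he]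

/-- The subgroup of torsion elements. -/
def InfiniteTorsionChain.subgroup (h : InfiniteTorsionChain G) : Subgroup G where
  carrier := {x | IsOfFinOrder x}
  one_mem' := IsOfFinOrder.one
  mul_mem' {x y} hx hy := by
    have key : ∀ {x y z : G}, IsOfFinOrder z → x ∈ zpowers z → y ∈ zpowers z →
        IsOfFinOrder (x * y) := fun hz hx hy =>
      ((isNonzeroPower_iff_of_isOfFinOrder hz).2 (mul_mem hx hy)).isOfFinOrder_iff.2 hz
    rcases h.2 x y hx hy with h | h
    · exact key hy h.mem_zpowers (mem_zpowers y)
    · exact key hx (mem_zpowers x) h.mem_zpowers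
  inv_mem' hx := IsOfFinOrder.inv hx

theorem InfiniteTorsionChain.mem_subgroup (h : InfiniteTorsionChain G) {x : G} :
    x ∈ h.subgroup ↔ IsOfFinOrder x := Iff.rfl

theorem InfiniteTorsionChain.normal (h : InfiniteTorsionChain G) : h.subgroup.Normal where
  conj_mem x hx g := by
    rw [h.mem_subgroup] at hx ⊢
    exact MonoidHom.isOfFinOrder (MulAut.conj g).toMonoidHom hx

theorem InfiniteTorsionChain.exists_root (h : InfiniteTorsionChain G) {x : G}
    (hx : IsOfFinOrder x) {n : ℕ} (hn : 0 < n) : ∃ y : G, IsOfFinOrder y ∧ y ^ n = x := by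
  obtain ⟨p, hp, hG⟩ := h.exists_primary
  obtain ⟨k, hk⟩ := hG x hx
  -- Since `n < p ^ n`, taking the `n`-th power loses fewer than `n` factors of `p`, so `y ^ n`
  -- still has order at least `p ^ k`.
  obtain ⟨y, hy⟩ := h.exists_orderOf_eq hp hG (k + n)
  have hyf : IsOfFinOrder y := orderOf_pos_iff.1 (hy ▸ pow_pos hp.pos _)
  obtain ⟨s, hs⟩ := hG (y ^ n) hyf.pow
  have hks : k ≤ s := by
    by_contra! hsk
    have h1 : y ^ (n * p ^ s) = 1 := by rw [pow_mul, ← hs, pow_orderOf_eq_one]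
    have h2 := orderOf_dvd_of_pow_eq_one h1
    rw [hy, show k + n = (k - s + n) + s by omega, pow_add,
      Nat.mul_dvd_mul_iff_right (pow_pos hp.pos s)] at h2
    have h3 := Nat.le_of_dvd hn h2
    have h4 : n < p ^ n := Nat.lt_pow_self hp.one_lt
    have h5 : p ^ n ≤ p ^ (k - s + n) := Nat.pow_le_pow_right hp.pos (by omega)
    omega
  obtain ⟨j, -, hj⟩ := (h.isNonzeroPower_iff hx hyf.pow).2
    (by rw [hk, hs]; exact pow_dvd_pow p hks)
  exact ⟨y ^ j, hyf.zpow, by rw [← hj, ← zpow_natCast, ← zpow_natCast, ← zpow_mul, ← zpow_mul,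
    mul_comm]⟩

theorem InfiniteTorsionChain.quotient_torsionFree (h : InfiniteTorsionChain G)
    [h.subgroup.Normal] (x : G ⧸ h.subgroup) (hx : IsOfFinOrder x) : x = 1 := by
  obtain ⟨x, rfl⟩ := QuotientGroup.mk_surjective x
  obtain ⟨n, hn, hxn⟩ := isOfFinOrder_iff_pow_eq_one.1 hx
  rw [← QuotientGroup.mk_pow, QuotientGroup.eq_one_iff, h.mem_subgroup, isOfFinOrder_pow] at hxn
  exact (QuotientGroup.eq_one_iff _).2 (hxn.resolve_right hn.ne')

variable [Group.IsNilpotent G]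

theorem InfiniteTorsionChain.le_center (h : InfiniteTorsionChain G) : h.subgroup ≤ center G :=
  le_center_of_chain G h.subgroup h.normal
    (fun x hx y hy => (h.2 x y hx hy).imp (·.mem_zpowers) (·.mem_zpowers)) (fun _ hx => hx)
    (fun _ hx _ hn => h.exists_root hx hn)

theorem InfiniteTorsionChain.commute (h : InfiniteTorsionChain G) {c : G} (hc : IsOfFinOrder c)
    (g : G) : Commute c g :=
  (mem_center_iff.1 (h.le_center hc) g).symm

theorem InfiniteTorsionChain.commutator_isOfFinOrder (h : InfiniteTorsionChain G) {a b : G}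
    {n : ℕ} (hn : 0 < n) (hab : Commute (a ^ n) b) : IsOfFinOrder ⁅a, b⁆ := by
  have := h.normal
  have h1 : Commute (a : G ⧸ h.subgroup) (b : G ⧸ h.subgroup) :=
    commute_of_commute_pow h.quotient_torsionFree hn (by
      rw [← QuotientGroup.mk_pow]
      exact hab.map (QuotientGroup.mk' h.subgroup))
  rw [commute_iff_commutator] at h1
  exact (QuotientGroup.eq_one_iff _).1 h1

theorem InfiniteTorsionChain.commutator_pow_eq_one (h : InfiniteTorsionChain G) {a b : G}
    {n : ℕ} (hn : 0 < n) (hab : Commute (a ^ n) b) : ⁅a, b⁆ ^ n = 1 := by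
  have h1 := pow_mul_eq_of_central (h.le_center (h.commutator_isOfFinOrder hn hab))
    (mul_eq_commutator_mul a b) n
  rwa [hab.eq, right_eq_mul] at h1

theorem InfiniteTorsionChain.commute_of_coprime_pow (h : InfiniteTorsionChain G) {a b : G}
    {m n : ℕ} (hm : 0 < m) (hn : 0 < n) (hmn : m.Coprime n) (hab : Commute (a ^ m) b)
    (hba : Commute a (b ^ n)) : Commute a b := by
  have h1 := h.commutator_pow_eq_one hm hab
  have h2 := h.commutator_pow_eq_one hn hba.symm
  rw [← commutatorElement_inv, inv_pow, inv_eq_one] at h2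
  rw [commute_iff_commutator, ← orderOf_eq_one_iff]
  exact Nat.eq_one_of_dvd_coprimes hmn (orderOf_dvd_of_pow_eq_one h1) (orderOf_dvd_of_pow_eq_one h2)

theorem InfiniteTorsionChain.div_isOfFinOrder (h : InfiniteTorsionChain G) {a b : G}
    {n : ℕ} (hn : 0 < n) (hab : a ^ n = b ^ n) : IsOfFinOrder (b * a⁻¹) := by
  have := h.normal
  have h1 : Commute (a : G ⧸ h.subgroup) (b : G ⧸ h.subgroup) :=
    commute_of_commute_pow h.quotient_torsionFree hn (by
      rw [← QuotientGroup.mk_pow, hab, QuotientGroup.mk_pow]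
      exact (Commute.refl _).pow_left n)
  have h2 : ((b * a⁻¹ : G) : G ⧸ h.subgroup) ^ n = 1 := by
    rw [QuotientGroup.mk_mul, QuotientGroup.mk_inv, h1.symm.inv_right.mul_pow, inv_pow,
      ← QuotientGroup.mk_pow, ← QuotientGroup.mk_pow, hab, mul_inv_cancel]
  have h3 := h.quotient_torsionFree _ (isOfFinOrder_iff_pow_eq_one.2 ⟨n, hn, h2⟩)
  exact (QuotientGroup.eq_one_iff _).1 h3

end Chain

/-! ### Recovering the prime by counting covers -/

section Covers

/-- `w` is a proper power of `z` with nothing strictly between. -/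
def IsCover {G : Type*} [Group G] (w z : G) : Prop :=
  w ≼ z ∧ ¬ z ≼ w ∧ ∀ u, w ≼ u → u ≼ z → u ≼ w ∨ z ≼ u

variable {G : Type*} [Group G] {p : ℕ}

theorem isCover_iff {w z : G} (hz : ¬ IsOfFinOrder z) :
    IsCover w z ↔ ∃ k : ℤ, k.natAbs.Prime ∧ z ^ k = w := by
  constructor
  · rintro ⟨⟨k, hk, rfl⟩, h1, h2⟩
    refine ⟨k, ?_, rfl⟩
    rw [← zpow_one z, ← zpow_mul, one_mul, zpow_isNonzeroPower_zpow hz one_ne_zero] at h1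
    rw [Nat.prime_def]
    constructor
    · by_contra! hlt
      have h3 := Int.natAbs_pos.2 hk
      exact h1 (Int.natAbs_dvd_natAbs.1 (by simp [show k.natAbs = 1 by omega]))
    · intro a ha
      have ha' : (a : ℤ) ∣ k := Int.natCast_dvd.2 ha
      have ha0 : (a : ℤ) ≠ 0 := fun h0 => hk (by simpa [h0] using ha')
      rcases h2 (z ^ (a : ℤ)) ((zpow_isNonzeroPower_zpow hz hk).2 ha')
        (zpow_isNonzeroPower z ha0) with h | h
      · rw [zpow_isNonzeroPower_zpow hz ha0] at h
        exact Or.inr (Nat.dvd_antisymm ha (by simpa using Int.natAbs_dvd_natAbs.2 h))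
      · rw [← zpow_one z, ← zpow_mul, one_mul, zpow_isNonzeroPower_zpow hz one_ne_zero] at h
        exact Or.inl (by simpa using Int.natAbs_dvd_natAbs.2 h)
  · rintro ⟨k, hk, rfl⟩
    have hk0 : k ≠ 0 := by rintro rfl; exact Nat.not_prime_zero hk
    refine ⟨zpow_isNonzeroPower z hk0, fun h => ?_, ?_⟩
    · rw [← zpow_one z, ← zpow_mul, one_mul, zpow_isNonzeroPower_zpow hz one_ne_zero] at h
      exact hk.one_lt.ne' (by simpa using Int.natAbs_dvd_natAbs.2 h)
    · rintro _ h ⟨n, hn, rfl⟩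
      rw [zpow_isNonzeroPower_zpow hz hk0] at h
      rcases (Nat.dvd_prime hk).1 (Int.natAbs_dvd_natAbs.2 h) with h' | h'
      · right
        rcases Int.natAbs_eq_iff.1 h' with rfl | rfl
        · simpa using IsNonzeroPower.refl z
        · simpa using isNonzeroPower_inv z
      · left
        rw [zpow_isNonzeroPower_zpow hz hn]
        exact Int.natAbs_dvd_natAbs.1 h'.symm.dvd

/-- Translates of `x` and `x⁻¹` by elements of order `p`. -/
def torsionTranslates (p : ℕ) (x : G) : Set G :=
  (fun c => c * x) '' {c | orderOf c = p} ∪ (fun c => c * x⁻¹) '' {c | orderOf c = p}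

theorem InfiniteTorsionChain.finite_setOf_orderOf (h : InfiniteTorsionChain G) (hp : p.Prime)
    (hG : TorsionIsPrimary p G) :
    {c : G | orderOf c = p}.Finite ∧ {c : G | orderOf c = p}.ncard = p - 1 := by
  obtain ⟨c, hc⟩ := h.exists_orderOf_eq hp hG 1
  rw [pow_one] at hc
  have hcf : IsOfFinOrder c := isOfFinOrder_of_prime (hc ▸ hp)
  rw [← hc, h.setOf_orderOf_eq hcf, ncard_generators hcf, hc, Nat.totient_prime hp]
  exact ⟨finite_generators hcf, rfl⟩

theorem InfiniteTorsionChain.finite_torsionTranslates (h : InfiniteTorsionChain G)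
    (hp : p.Prime) (hG : TorsionIsPrimary p G) (x : G) : (torsionTranslates p x).Finite :=
  ((h.finite_setOf_orderOf hp hG).1.image _).union ((h.finite_setOf_orderOf hp hG).1.image _)

theorem InfiniteTorsionChain.ncard_torsionTranslates (h : InfiniteTorsionChain G) (hp : p.Prime)
    (hG : TorsionIsPrimary p G) {x : G} (hx : ¬ IsOfFinOrder x) :
    (torsionTranslates p x).ncard = (p - 1) + (p - 1) := by
  obtain ⟨h1, h2⟩ := h.finite_setOf_orderOf hp hG
  rw [torsionTranslates, Set.ncard_union_eq ?_ (h1.image _) (h1.image _),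
    Set.ncard_image_of_injective _ (mul_left_injective x),
    Set.ncard_image_of_injective _ (mul_left_injective x⁻¹), h2]
  rw [Set.disjoint_left]
  rintro _ ⟨c, hc, rfl⟩ ⟨d, hd, hcd⟩
  have hcf : IsOfFinOrder c := isOfFinOrder_of_prime (by rw [show orderOf c = p from hc]; exact hp)
  have hdf : IsOfFinOrder d := isOfFinOrder_of_prime (by rw [show orderOf d = p from hd]; exact hp)
  have h3 : x ^ 2 = c⁻¹ * d := by
    simp only at hcd
    rw [eq_inv_mul_iff_mul_eq, pow_two, ← mul_assoc, ← hcd]; group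
  have h4 : IsOfFinOrder (c⁻¹ * d) := h.subgroup.mul_mem (h.subgroup.inv_mem hcf) hdf
  rw [← h3, isOfFinOrder_pow] at h4
  exact hx (h4.resolve_right two_ne_zero)

theorem eq_one_of_mem_zpowers {u c : G} (hu : ¬ IsOfFinOrder u) (hc : IsOfFinOrder c)
    (h : c ∈ zpowers u) : c = 1 := by
  obtain ⟨n, rfl⟩ := h
  simp only at hc ⊢
  by_cases hn : n = 0
  · simp [hn]
  · exact absurd ((isOfFinOrder_zpow_iff hn).1 hc) hu

variable [Group.IsNilpotent G]

/-- A central factor of order `p` disappears in the `p`-th power. A common root would contain this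
factor in an infinite cyclic group. -/
theorem InfiniteTorsionChain.isCover_of_mem_translates (h : InfiniteTorsionChain G)
    (hp : p.Prime) {x z : G} (hx : ¬ IsOfFinOrder x) (hz : z ∈ torsionTranslates p x) :
    IsCover (x ^ p) z ∧ ¬ ∃ u, x ≼ u ∧ z ≼ u := by
  obtain ⟨c, hc, y, hy, rfl⟩ : ∃ c, orderOf c = p ∧ ∃ y, (y = x ∨ y = x⁻¹) ∧ z = c * y := by
    rcases hz with ⟨c, hc, rfl⟩ | ⟨c, hc, rfl⟩
    · exact ⟨c, hc, x, Or.inl rfl, rfl⟩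
    · exact ⟨c, hc, x⁻¹, Or.inr rfl, rfl⟩
  have hcf : IsOfFinOrder c := isOfFinOrder_of_prime (hc ▸ hp)
  have hcy : (c * y) ^ p = y ^ p := by
    rw [(h.commute hcf y).mul_pow, ← hc, pow_orderOf_eq_one, one_mul]
  have hyx : x ≼ y := by
    rcases hy with rfl | rfl
    exacts [.refl _, isNonzeroPower_inv _]
  have hxy : y ≼ x := by
    rcases hy with rfl | rfl
    exacts [.refl _, inv_isNonzeroPower _]
  have hz : ¬ IsOfFinOrder (c * y) := by
    intro hz
    have h1 : IsOfFinOrder (y ^ p) := hcy ▸ hz.pow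
    rw [isOfFinOrder_pow, hxy.isOfFinOrder_iff] at h1
    exact hx (h1.resolve_right hp.ne_zero)
  constructor
  · rw [isCover_iff hz]
    rcases hy with rfl | rfl
    · exact ⟨p, by simpa using hp, by rw [zpow_natCast, hcy]⟩
    · exact ⟨-p, by simpa using hp, by rw [zpow_neg, zpow_natCast, hcy, inv_pow, inv_inv]⟩
  · rintro ⟨u, hxu, hzu⟩
    have hu : ¬ IsOfFinOrder u := fun hu => hx (hxu.isOfFinOrder_iff.2 hu)
    have h2 : c ∈ zpowers u := by
      simpa using mul_mem hzu.mem_zpowers (inv_mem (hxy.trans hxu).mem_zpowers)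
    rw [eq_one_of_mem_zpowers hu hcf h2, orderOf_one] at hc
    exact hp.one_lt.ne hc

/-- Let `w = y ^ k = z ^ l` with `|k|` and `|l|` prime. If they differ, `y` and `z` commute and
Bézout gives a common root. If they agree, `z` or its inverse is `c * y` with `c` central torsion
killed by `|k|`; the lack of a common root gives `c ≠ 1`, so `c` has order `p`. -/
theorem InfiniteTorsionChain.mem_translates_of_isCover (h : InfiniteTorsionChain G)
    (hp : p.Prime) (hG : TorsionIsPrimary p G) {w y z : G} (hy : ¬ IsOfFinOrder y)
    (hwy : IsCover w y) (hwz : IsCover w z) (hr : ¬ ∃ u, y ≼ u ∧ z ≼ u) :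
    z ∈ torsionTranslates p y := by
  have hz : ¬ IsOfFinOrder z := fun hz =>
    hy (hwy.1.isOfFinOrder_iff.1 (hwz.1.isOfFinOrder_iff.2 hz))
  obtain ⟨k, hk, rfl⟩ := (isCover_iff hy).1 hwy
  obtain ⟨l, hl, hlk⟩ := (isCover_iff hz).1 hwz
  by_cases hne : k.natAbs = l.natAbs
  · obtain ⟨z', hz', hzz, hpow⟩ : ∃ z', (z' = z ∨ z' = z⁻¹) ∧ z' ≼ z ∧
        y ^ k.natAbs = z' ^ k.natAbs := by
      have hcast : ∀ v : G, v ^ k.natAbs = v ^ (k.natAbs : ℤ) := fun v => (zpow_natCast _ _).symm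
      rcases Int.natAbs_eq_natAbs_iff.1 hne with rfl | rfl
      · refine ⟨z, Or.inl rfl, .refl z, ?_⟩
        rw [hcast, hcast]
        rcases Int.natAbs_eq k with h' | h'
        · rw [← h', hlk]
        · rw [show (k.natAbs : ℤ) = -k by omega, zpow_neg, zpow_neg, hlk]
      · refine ⟨z⁻¹, Or.inr rfl, inv_isNonzeroPower z, ?_⟩
        rw [hcast, hcast, inv_zpow, ← zpow_neg]
        rcases Int.natAbs_eq (-l) with h' | h'
        · rw [← h', ← hlk, neg_neg]
        · rw [show (((-l).natAbs : ℕ) : ℤ) = l by omega, zpow_neg, hlk, zpow_neg, inv_inv]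
    have hcf := h.div_isOfFinOrder hk.pos hpow
    set c := z' * y⁻¹ with hc
    have hz'c : z' = c * y := by rw [hc]; group
    have hc1 : c ^ k.natAbs = 1 := by
      rw [hz'c, (h.commute hcf y).mul_pow, right_eq_mul] at hpow
      exact hpow
    have hcne : c ≠ 1 := by
      intro h1
      rw [h1, one_mul] at hz'c
      refine hr ⟨z, ?_, .refl z⟩
      rwa [← hz'c]
    have hcp : orderOf c = p := by
      obtain ⟨j, hj⟩ := hG c hcf
      have h1 : orderOf c = k.natAbs := ((Nat.dvd_prime hk).1
        (orderOf_dvd_of_pow_eq_one hc1)).resolve_left fun h1 => hcne (orderOf_eq_one_iff.1 h1)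
      rw [h1] at hj ⊢
      have hj0 : j ≠ 0 := by rintro rfl; exact hk.one_lt.ne' (by simpa using hj)
      exact ((Nat.prime_dvd_prime_iff_eq hp hk).1 (hj ▸ dvd_pow_self p hj0)).symm
    rcases hz' with rfl | rfl
    · exact Or.inl ⟨c, hcp, hz'c.symm⟩
    · refine Or.inr ⟨c⁻¹, by rw [Set.mem_ofPred_eq, orderOf_inv, hcp], ?_⟩
      change c⁻¹ * y⁻¹ = z
      rw [← inv_inj, ← hz'c.symm.trans rfl, (h.commute hcf y).eq]
      group
  · exfalso
    have hcop := (Nat.coprime_primes hk hl).2 hne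
    have hyz : Commute y z := by
      refine h.commute_of_coprime_pow hk.pos hl.pos hcop ?_ ?_
      · have h1 : Commute (y ^ k) z := by rw [← hlk]; exact Commute.zpow_self z l
        rcases Int.natAbs_eq k with h' | h'
        · rw [← zpow_natCast, ← h']; exact h1
        · rw [← zpow_natCast, show (k.natAbs : ℤ) = -k by omega, zpow_neg]; exact h1.inv_left
      · have h1 : Commute y (z ^ l) := by rw [hlk]; exact Commute.self_zpow y k
        rcases Int.natAbs_eq l with h' | h'
        · rw [← zpow_natCast, ← h']; exact h1
        · rw [← zpow_natCast, show (l.natAbs : ℤ) = -l by omega, zpow_neg]; exact h1.inv_right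
    obtain ⟨a, b, hab⟩ : IsCoprime k l := Int.isCoprime_iff_gcd_eq_one.2 hcop
    have hk0 : k ≠ 0 := by rintro rfl; exact Nat.not_prime_zero hk
    have hl0 : l ≠ 0 := by rintro rfl; exact Nat.not_prime_zero hl
    have hcomm : Commute (y ^ b) (z ^ a) := (hyz.zpow_left b).zpow_right a
    -- With `a * k + b * l = 1`, the `l`-th power of this element is `y` and its `k`-th power is
    -- `z`.
    refine hr ⟨y ^ b * z ^ a, ⟨l, hl0, ?_⟩, ⟨k, hk0, ?_⟩⟩
    · rw [hcomm.mul_zpow, ← zpow_mul, ← zpow_mul, mul_comm a l, zpow_mul z, hlk, ← zpow_mul,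
        ← zpow_add, show b * l + k * a = 1 by linarith, zpow_one]
    · rw [hcomm.mul_zpow, ← zpow_mul, ← zpow_mul, mul_comm b k, zpow_mul y, ← hlk, ← zpow_mul,
        ← zpow_add, show l * b + a * k = 1 by linarith, zpow_one]

/-- Any translate of `x` has no common root with `x`, so `f` preserves direction on this component.
It therefore carries the translates of `x` into those of `f x`, and the counts compare. -/
theorem prime_le_of_infiniteTorsionChain {H : Type*} [Group H] [Group.IsNilpotent H] {f : G ≃ H}
    {q : ℕ} (hf : PreservesLinked f) (hp : p.Prime) (hq : q.Prime) (hcG : InfiniteTorsionChain G)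
    (hcH : InfiniteTorsionChain H) (hG : TorsionIsPrimary p G) (hH : TorsionIsPrimary q H) {x : G}
    (hx : ¬ IsOfFinOrder x) : p ≤ q := by
  have hpz : (p : ℤ) ≠ 0 := by exact_mod_cast hp.ne_zero
  have hwx : IsCover (x ^ p) x :=
    (isCover_iff hx).2 ⟨p, by simpa using hp, zpow_natCast x p⟩
  have hfx : ¬ IsOfFinOrder (f x) := by rwa [hf.isOfFinOrder_iff]
  have hcov : ∀ z ∈ torsionTranslates p x, Commensurable x z := fun z hz =>
    hwx.1.commensurable.symm.trans (hcG.isCover_of_mem_translates hp hx hz).1.1.commensurable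
  obtain ⟨c, hc⟩ := hcG.exists_orderOf_eq hp hG 1
  rw [pow_one] at hc
  have hcx : c * x ∈ torsionTranslates p x := Or.inl ⟨c, hc, rfl⟩
  have hpres := preserves_of_no_common_root hf hx (hcov _ hcx)
    (hcG.isCover_of_mem_translates hp hx hcx).2
  have hback : ∀ {a : G} {u : H}, Commensurable x a → Commensurable (f a) u →
      ∃ v, f v = u ∧ Commensurable x v := fun {a u} ha hu => by
    obtain ⟨v, rfl⟩ := f.surjective u
    exact ⟨v, rfl, ha.trans (hf.commensurable_iff.1 hu)⟩
  have hcovf : ∀ z, Commensurable x z → IsCover (x ^ p) z → IsCover (f (x ^ p)) (f z) := by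
    intro z hz hcz
    have hw : Commensurable x (x ^ p) := hwx.1.commensurable.symm
    refine ⟨(hpres _ _ hw hz).2 hcz.1, fun h' => hcz.2.1 ((hpres _ _ hz hw).1 h'), ?_⟩
    intro u hu huz
    obtain ⟨v, rfl, hv⟩ := hback hw hu.commensurable
    rw [hpres _ _ hw hv] at hu
    rw [hpres _ _ hv hz] at huz
    rw [hpres _ _ hv hw, hpres _ _ hz hv]
    exact hcz.2.2 v hu huz
  have hsub : f '' torsionTranslates p x ⊆ torsionTranslates q (f x) := by
    rintro _ ⟨z, hz, rfl⟩
    obtain ⟨h1, h2⟩ := hcG.isCover_of_mem_translates hp hx hz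
    refine hcH.mem_translates_of_isCover hq hH hfx (hcovf x (.refl x) hwx)
      (hcovf z (hcov z hz) h1) ?_
    rintro ⟨u, hu, hu'⟩
    obtain ⟨v, rfl, hv⟩ := hback (.refl x) hu.commensurable
    exact h2 ⟨v, (hpres _ _ (.refl x) hv).1 hu, (hpres _ _ (hcov z hz) hv).1 hu'⟩
  have hcard := Set.ncard_le_ncard hsub (hcH.finite_torsionTranslates hq hH (f x))
  rw [Set.ncard_image_of_injective _ f.injective, hcG.ncard_torsionTranslates hp hG hx,
    hcH.ncard_torsionTranslates hq hH hfx] at hcard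
  have := hp.two_le
  have := hq.two_le
  omega

end Covers

/-! ### Prüfer groups as infinite torsion chains -/

section Prufer

theorem complexUnits_mem_zpowers {x y : ℂˣ} (hy : IsOfFinOrder y) (h : orderOf x ∣ orderOf y) :
    x ∈ zpowers y := by
  have hprim : IsPrimitiveRoot (y : ℂ) (orderOf y) :=
    IsPrimitiveRoot.coe_units_iff.2 (IsPrimitiveRoot.orderOf y)
  have hx : (x : ℂ) ^ orderOf y = 1 := by
    rw [← Units.val_pow_eq_pow_val, orderOf_dvd_iff_pow_eq_one.1 h, Units.val_one]
  have : NeZero (orderOf y) := ⟨hy.orderOf_pos.ne'⟩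
  obtain ⟨i, -, hi⟩ := hprim.eq_pow_of_pow_eq_one hx
  exact ⟨i, by simpa using Units.ext hi⟩

theorem exists_complexUnits_orderOf {n : ℕ} (hn : n ≠ 0) : ∃ x : ℂˣ, orderOf x = n := by
  have h := Complex.isPrimitiveRoot_exp n hn
  exact ⟨(h.isUnit hn).unit, by rw [← orderOf_units, IsUnit.unit_spec, ← h.eq_orderOf]⟩

theorem primaryComponent_infiniteTorsionChain {p : ℕ} (hp : p.Prime) :
    (∀ x : CommGroup.primaryComponent ℂˣ p, IsOfFinOrder x) ∧
      InfiniteTorsionChain (CommGroup.primaryComponent ℂˣ p) ∧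
      TorsionIsPrimary p (CommGroup.primaryComponent ℂˣ p) := by
  have : Fact p.Prime := ⟨hp⟩
  have hord : ∀ x : CommGroup.primaryComponent ℂˣ p, ∃ k, orderOf x = p ^ k := fun x => by
    obtain ⟨k, hk⟩ := CommGroup.mem_primaryComponent_iff_orderOf.1 x.2
    exact ⟨k, by rw [← hk, Subgroup.orderOf_coe]⟩
  have hfin : ∀ x : CommGroup.primaryComponent ℂˣ p, IsOfFinOrder x := fun x => by
    obtain ⟨k, hk⟩ := hord x
    exact orderOf_pos_iff.1 (hk ▸ pow_pos hp.pos k)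
  have hmem : ∀ x y : CommGroup.primaryComponent ℂˣ p, orderOf x ∣ orderOf y → x ≼ y := by
    intro x y h
    rw [isNonzeroPower_iff_of_isOfFinOrder (hfin y)]
    obtain ⟨i, hi⟩ := complexUnits_mem_zpowers (x := x) (y := y)
      ((Subgroup.subtype _).isOfFinOrder (hfin y)) (by simpa using h)
    exact ⟨i, Subtype.ext hi⟩
  refine ⟨hfin, ⟨?_, ?_⟩, fun x _ => hord x⟩
  · choose ζ hζ using fun k : ℕ => exists_complexUnits_orderOf (pow_ne_zero k hp.ne_zero)
    refine Set.infinite_of_injective_forall_mem (f := fun k : ℕ =>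
      (⟨ζ k, CommGroup.mem_primaryComponent_iff_orderOf.2 ⟨k, hζ k⟩⟩ :
        CommGroup.primaryComponent ℂˣ p)) (fun a b hab => ?_) (fun k => hfin _)
    have h1 : ζ a = ζ b := congrArg Subtype.val hab
    exact Nat.pow_right_injective hp.two_le (by simp only; rw [← hζ, h1, hζ])
  · intro x y _ _
    obtain ⟨i, hi⟩ := hord x
    obtain ⟨j, hj⟩ := hord y
    rcases le_total i j with hij | hij
    · exact Or.inl (hmem x y (by rw [hi, hj]; exact pow_dvd_pow p hij))
    · exact Or.inr (hmem y x (by rw [hi, hj]; exact pow_dvd_pow p hij))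

variable {G : Type*} [Group G]

theorem mulEquiv_preservesLinked {H : Type*} [Group H] (e : G ≃* H) :
    PreservesLinked e.toEquiv := by
  have key : ∀ x y, e x ≼ e y ↔ x ≼ y := fun x y => exists_congr fun n =>
    and_congr_right fun _ => by rw [← map_zpow, e.injective.eq_iff]
  exact fun x y => or_congr (key x y) (key y x)

theorem torsionIsPrimary_of_mulEquiv {H : Type*} [Group H] {p : ℕ} (e : G ≃* H)
    (h : TorsionIsPrimary p G) : TorsionIsPrimary p H := fun x hx => by
  obtain ⟨k, hk⟩ := h (e.symm x) (e.symm.toMonoidHom.isOfFinOrder hx)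
  exact ⟨k, by rw [← hk, MulEquiv.orderOf_eq]⟩

theorem chain_of_mulEquiv_primaryComponent {p : ℕ} (hp : p.Prime)
    (e : CommGroup.primaryComponent ℂˣ p ≃* G) :
    (∀ x : G, IsOfFinOrder x) ∧ InfiniteTorsionChain G ∧ TorsionIsPrimary p G := by
  obtain ⟨h1, h2, h3⟩ := primaryComponent_infiniteTorsionChain hp
  refine ⟨fun x => ?_, h2.map (mulEquiv_preservesLinked e), torsionIsPrimary_of_mulEquiv e h3⟩
  rw [← e.apply_symm_apply x]
  exact e.toMonoidHom.isOfFinOrder (h1 _)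

theorem complexUnits_baer : Module.Baer ℤ (Additive ℂˣ) := by
  have hroot : ∀ {n : ℤ}, n ≠ 0 → Function.Surjective fun a : Additive ℂˣ => n • a := by
    intro n hn a
    have hnat : ∃ b : Additive ℂˣ, n.natAbs • b = a := by
      obtain ⟨z, hz⟩ := IsAlgClosed.exists_pow_nat_eq ((Additive.toMul a : ℂˣ) : ℂ)
        (Int.natAbs_pos.2 hn)
      have hz0 : z ≠ 0 := by
        rintro rfl
        rw [zero_pow (Int.natAbs_ne_zero.2 hn)] at hz
        exact (Additive.toMul a).ne_zero hz.symm
      exact ⟨Additive.ofMul (Units.mk0 z hz0), congrArg Additive.ofMul (Units.ext hz)⟩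
    obtain ⟨b, hb⟩ := hnat
    rcases Int.natAbs_eq n with h | h
    · exact ⟨b, by simp only; rw [h, natCast_zsmul, hb]⟩
    · exact ⟨-b, by simp only; rw [h, neg_smul_neg, natCast_zsmul, hb]⟩
  have : DivisibleBy (Additive ℂˣ) ℤ := divisibleByOfSMulRightSurj _ _ hroot
  exact Module.Baer.of_divisible _

theorem exists_complexUnits_extension {A : Type*} [CommGroup A] (K : Subgroup A) (g : K →* ℂˣ) :
    ∃ φ : A →* ℂˣ, ∀ x : K, φ x = g x := by
  obtain ⟨h, hh⟩ := complexUnits_baer.extension_property_addMonoidHom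
    (MonoidHom.toAdditive K.subtype) (fun x y hxy => Subtype.val_injective hxy)
    (MonoidHom.toAdditive g)
  exact ⟨MonoidHom.toAdditive.symm h, fun x => DFunLike.congr_fun hh (Additive.ofMul x)⟩

/-- An embedding of the subgroup of order `p` into the divisible group `ℂˣ` extends to `G`. It stays
injective because every element outside that subgroup has its generator as a power. -/
theorem isPruferGroup_of_infiniteTorsionChain (hfin : ∀ x : G, IsOfFinOrder x)
    (h : InfiniteTorsionChain G) : IsPruferGroup G := by
  obtain ⟨p, hp, hG⟩ := h.exists_primary
  have : Fact p.Prime := ⟨hp⟩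
  refine ⟨p, hp, ?_⟩
  have hcomm : ∀ a b : G, a * b = b * a := by
    intro a b
    rcases h.2 a b (hfin a) (hfin b) with ⟨n, -, rfl⟩ | ⟨n, -, rfl⟩
    · exact Commute.zpow_self b n
    · exact Commute.self_zpow a n
  let _ : CommGroup G := { ‹Group G› with mul_comm := hcomm }
  obtain ⟨x, hx⟩ := h.exists_orderOf_eq hp hG 1
  rw [pow_one] at hx
  obtain ⟨ζ, hζ⟩ := exists_complexUnits_orderOf hp.ne_zero
  let e : zpowers x ≃* zpowers ζ :=
    mulEquivOfCyclicCardEq (by rw [Nat.card_zpowers, Nat.card_zpowers, hx, hζ])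
  obtain ⟨φ, hφ⟩ := exists_complexUnits_extension (zpowers x)
    ((zpowers ζ).subtype.comp e.toMonoidHom)
  have hker : ∀ z ∈ zpowers x, φ z = 1 → z = 1 := by
    intro z hz hz1
    have h1 := hφ ⟨z, hz⟩
    rw [show φ ((⟨z, hz⟩ : zpowers x) : G) = 1 from hz1] at h1
    have h2 : e ⟨z, hz⟩ = 1 := Subtype.ext h1.symm
    rw [map_eq_one_iff e e.injective] at h2
    exact congrArg Subtype.val h2
  have hinj : Function.Injective φ := by
    refine (injective_iff_map_eq_one φ).2 fun z hz => ?_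
    rcases h.2 z x (hfin z) (hfin x) with h1 | ⟨n, -, h1⟩
    · exact hker z h1.mem_zpowers hz
    · have h2 := hker x (mem_zpowers x) (by rw [← h1, map_zpow, hz, one_zpow])
      rw [h2, orderOf_one] at hx
      exact absurd hx hp.one_lt.ne
  have hmem : ∀ z, φ z ∈ CommGroup.primaryComponent ℂˣ p := fun z => by
    obtain ⟨k, hk⟩ := hG z (hfin z)
    exact CommGroup.mem_primaryComponent_iff_orderOf.2 ⟨k, by rw [orderOf_injective φ hinj, hk]⟩
  refine ⟨MulEquiv.ofBijective (φ.codRestrict _ hmem) ⟨fun a b hab => ?_, fun w => ?_⟩⟩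
  · exact hinj (congrArg Subtype.val hab)
  · obtain ⟨k, hk⟩ := CommGroup.mem_primaryComponent_iff_orderOf.1 w.2
    obtain ⟨y, hy⟩ := h.exists_orderOf_eq hp hG k
    obtain ⟨i, hi⟩ := complexUnits_mem_zpowers (x := w) (φ.isOfFinOrder (hfin y))
      (by rw [hk, orderOf_injective φ hinj, hy])
    exact ⟨y ^ i, Subtype.ext (by rw [← hi]; exact map_zpow φ y i)⟩

theorem InfiniteTorsionChain.countable (hfin : ∀ x : G, IsOfFinOrder x)
    (h : InfiniteTorsionChain G) : Countable G := by
  obtain ⟨p, hp, hG⟩ := h.exists_primary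
  choose y hy using h.exists_orderOf_eq hp hG
  have huniv : (Set.univ : Set G) ⊆ ⋃ k, (zpowers (y k) : Set G) := by
    intro x _
    obtain ⟨k, hk⟩ := hG x (hfin x)
    exact Set.mem_iUnion.2 ⟨k, ((h.isNonzeroPower_iff (hfin x) (hfin _)).2
      (by rw [hk, hy])).mem_zpowers⟩
  exact Set.countable_univ_iff.1 ((Set.countable_iUnion fun k =>
    (hfin (y k)).finite_zpowers.countable).mono huniv)

theorem orderOf_eq_of_preserves {H : Type*} [Group H] {g : G ≃ H}
    (hg : ∀ a b, g a ≼ g b ↔ a ≼ b) {x : G} (hx : IsOfFinOrder x) (hgx : IsOfFinOrder (g x)) :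
    orderOf (g x) = orderOf x := by
  rw [← Nat.card_zpowers, ← Nat.card_zpowers, ← SetLike.coe_sort_coe, ← SetLike.coe_sort_coe,
    Nat.card_coe_set_eq, Nat.card_coe_set_eq, ← Set.ncard_image_of_injective _ g.injective]
  congr 1
  ext y
  obtain ⟨z, rfl⟩ := g.surjective y
  rw [g.injective.mem_set_image, SetLike.mem_coe, SetLike.mem_coe,
    ← isNonzeroPower_iff_of_isOfFinOrder hgx, hg, isNonzeroPower_iff_of_isOfFinOrder hx]

end Prufer

/-! ### Passing to the graphs, and the two final statements -/

section Graphs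

variable {G : Type*} {H : Type*} [Group G] [Group H]

theorem powerGraph_adj {x y : G} : (powerGraph G).Adj x y ↔ x ≠ y ∧ Linked x y := by
  change x ≠ y ∧ ((x ≠ y ∧ x ≼ y) ∨ (y ≠ x ∧ y ≼ x)) ↔ _
  rw [Linked]
  tauto

theorem powerGraphIso_iff : PowerGraphIso G H ↔ ∃ f : G ≃ H, PreservesLinked f := by
  constructor
  · rintro ⟨f⟩
    refine ⟨f.toEquiv, fun x y => ?_⟩
    by_cases hxy : x = y
    · subst hxy
      exact iff_of_true (.refl _) (.refl _)
    · have h := f.map_rel_iff (a := x) (b := y)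
      rw [powerGraph_adj, powerGraph_adj] at h
      have hne : f x ≠ f y := fun h => hxy (f.injective h)
      exact ⟨fun h' => (h.1 ⟨hne, h'⟩).2, fun h' => (h.2 ⟨hxy, h'⟩).2⟩
  · rintro ⟨f, hf⟩
    refine ⟨⟨f, fun {x y} => ?_⟩⟩
    rw [powerGraph_adj, powerGraph_adj, hf, f.injective.ne_iff]

theorem directedPowerGraphIso_iff :
    DirectedPowerGraphIso G H ↔ ∃ f : G ≃ H, ∀ x y, f x ≼ f y ↔ x ≼ y := by
  constructor
  · rintro ⟨f⟩
    refine ⟨f.toEquiv, fun x y => ?_⟩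
    by_cases hxy : x = y
    · subst hxy
      exact iff_of_true (.refl _) (.refl _)
    · have h : (f x ≠ f y ∧ f x ≼ f y) ↔ (x ≠ y ∧ x ≼ y) := f.map_rel_iff (a := x) (b := y)
      have hne : f x ≠ f y := fun h => hxy (f.injective h)
      exact ⟨fun h' => (h.1 ⟨hne, h'⟩).2, fun h' => (h.2 ⟨hxy, h'⟩).2⟩
  · rintro ⟨f, hf⟩
    exact ⟨⟨f, fun {x y} => and_congr f.injective.ne_iff (hf x y)⟩⟩

theorem isPruferGroup_iff :
    IsPruferGroup G ↔ (∀ x : G, IsOfFinOrder x) ∧ InfiniteTorsionChain G := by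
  constructor
  · rintro ⟨p, hp, ⟨e⟩⟩
    obtain ⟨h1, h2, -⟩ := chain_of_mulEquiv_primaryComponent hp e.symm
    exact ⟨h1, h2⟩
  · exact fun h => isPruferGroup_of_infiniteTorsionChain h.1 h.2

theorem directedPowerGraphIso_of_powerGraphIso [Group.IsNilpotent G] [Group.IsNilpotent H]
    (hG : ¬ IsPruferGroup G) (h : PowerGraphIso G H) : DirectedPowerGraphIso G H := by
  obtain ⟨f, hf⟩ := powerGraphIso_iff.1 h
  suffices h1 : ComponentIso (1 : G) (1 : H) by
    refine directedPowerGraphIso_iff.2 (exists_equiv_of_componentIso hf fun x => ?_)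
    by_cases hx : IsOfFinOrder x
    · exact h1.congr (commensurable_one_iff.2 hx)
        (commensurable_one_iff.2 ((hf.isOfFinOrder_iff x).2 hx))
    · exact componentIso_of_not_isOfFinOrder hf hx
  refine (componentIso_one_or_infiniteTorsionChain hf).elim id ?_
  rintro ⟨hcG, hcH⟩
  obtain ⟨p, hp, hpG⟩ := hcG.exists_primary
  obtain ⟨q, hq, hqH⟩ := hcH.exists_primary
  have hinf : ∃ x : G, ¬ IsOfFinOrder x := by
    by_contra! hfin
    exact hG (isPruferGroup_iff.2 ⟨hfin, hcG⟩)
  obtain ⟨x, hx⟩ := hinf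
  have hpq : p = q := le_antisymm
    (prime_le_of_infiniteTorsionChain hf hp hq hcG hcH hpG hqH hx)
    (prime_le_of_infiniteTorsionChain hf.symm hq hp hcH hcG hqH hpG
      (by rwa [hf.isOfFinOrder_iff x] : ¬ IsOfFinOrder (f x)))
  subst hpq
  exact componentIso_one_of_infiniteTorsionChain hp hcG hcH hpG hqH

theorem exists_not_directedPowerGraphIso (hG : IsPruferGroup G) :
    ∃ (H : Type v) (_ : Group H) (_ : Group.IsNilpotent H),
      PowerGraphIso G H ∧ ¬ DirectedPowerGraphIso G H := by
  obtain ⟨p, hp, ⟨e⟩⟩ := hG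
  obtain ⟨q, hpq, hq⟩ := Nat.exists_infinite_primes (p + 1)
  obtain ⟨hfG, hcG, hpG⟩ := chain_of_mulEquiv_primaryComponent hp e.symm
  obtain ⟨hfH, hcH, hqH⟩ := chain_of_mulEquiv_primaryComponent hq
    (MulEquiv.ulift (α := CommGroup.primaryComponent ℂˣ q)).symm
  refine ⟨ULift.{v} (CommGroup.primaryComponent ℂˣ q), inferInstance,
    CommGroup.isNilpotent, ?_, ?_⟩
  · have := hcG.countable hfG
    have := hcH.countable hfH
    have : Infinite G := Set.infinite_univ_iff.1 (hcG.1.mono (Set.subset_univ _))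
    have : Infinite (ULift.{v} (CommGroup.primaryComponent ℂˣ q)) :=
      Set.infinite_univ_iff.1 (hcH.1.mono (Set.subset_univ _))
    obtain ⟨f⟩ := nonempty_equiv_of_countable (α := G)
      (β := ULift.{v} (CommGroup.primaryComponent ℂˣ q))
    -- Both power graphs are complete, so any bijection is an isomorphism.
    exact powerGraphIso_iff.2 ⟨f, fun x y =>
      iff_of_true (hcH.2 _ _ (hfH _) (hfH _)) (hcG.2 _ _ (hfG _) (hfG _))⟩
  · intro h
    obtain ⟨g, hg⟩ := directedPowerGraphIso_iff.1 h
    obtain ⟨x, hx⟩ := hcG.exists_orderOf_eq hp hpG 1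
    have h1 := orderOf_eq_of_preserves hg (hfG x) (hfH (g x))
    obtain ⟨k, hk⟩ := hqH (g x) (hfH _)
    rw [hk, hx, pow_one] at h1
    have hk0 : k ≠ 0 := by rintro rfl; exact hp.one_lt.ne (by simpa using h1)
    have := (Nat.prime_dvd_prime_iff_eq hq hp).1 (h1 ▸ dvd_pow_self q hk0)
    omega

end Graphs

end NilpotentPowerGraph

theorem mainTheorem1 :
    (∀ (G : Type u) (H : Type v) [Group G] [Group H] [Group.IsNilpotent G] [Group.IsNilpotent H],
      ¬ IsPruferGroup G → ¬ IsPruferGroup H →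
      PowerGraphIso G H → DirectedPowerGraphIso G H) ∧
    (∀ (G : Type u) [Group G] [Group.IsNilpotent G],
      (∃ (H : Type v) (_ : Group H) (_ : Group.IsNilpotent H),
        PowerGraphIso G H ∧ ¬ DirectedPowerGraphIso G H) ↔ IsPruferGroup G) := by
  refine ⟨fun G H _ _ _ _ hG _ h =>
    NilpotentPowerGraph.directedPowerGraphIso_of_powerGraphIso hG h, fun G _ _ => ⟨?_, fun hG =>
    NilpotentPowerGraph.exists_not_directedPowerGraphIso hG⟩⟩
  rintro ⟨H, _, _, h1, h2⟩
  by_contra hG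
  exact h2 (NilpotentPowerGraph.directedPowerGraphIso_of_powerGraphIso hG h1)
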